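/- Let $F$ be an ordered field, let $\mathcal M=(M;+,<,0,1,(x\mapsto\alpha x)_{\alpha\in F})$ be an ordered $F$-vector space with a distinguished positive element $1$, and let $Q\subsetneq M$ be a proper $F$-subspace containing $1$ that is dense in $M$ (for all $a<b$ in $M$ there is $q\in Q$ with $a<q<b$). Let $T_{POVS}$ be the complete first-order theory of the two-sorted structure $$(M,\,M/Q;\;+,<,0,1,(x\mapsto\alpha x)_{\alpha\in F},\,Q,\,\pi,\,+_Q,\,(x\mapsto\alpha_Q x)_{\alpha\in F}),$$ where $M$ is called the home sort, $M/Q$ the quotient sort, $Q$ is a unary predicate on $M$, $\pi:M\to M/Q$ is the quotient map, and $+_Q,\alpha_Q$ are the vector space operations of $M/Q$. For a formula $\varphi(x,z)$, where $x$ and $z$ are finite tuples of variables of any sorts, and a structure $\mathcal N$, write $\varphi(N,b)=\{a:\mathcal N\models\varphi(a,b)\}$ and $\varphi(a,N)=\{b:\mathcal N\models\varphi(a,b)\}$. Let $\mathcal N$ be a model of a theory $T$. A finite non-empty set $Y$ of tuples from a product of sorts of $\mathcal N$ weakly codes a set $S$ via a formula $\psi(x,y)$ if, for all $c$, $\psi(N,c)=S$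 if and only if $c\in Y$; the set $S$ is weakly coded if such $Y$ and $\psi$ exist. The family $(\varphi(N,b))_b$ is uniformly weakly coded if there are formulas $\psi(x,y)$ and $\chi(y,z)$ without parameters such that for every $b$ the set $\chi(N,b)$ is finite and non-empty and weakly codes $\varphi(N,b)$ via $\psi$. It is uniformly weakly coded on non-empty sets if there are $\psi$ and $\chi$ such that this holds for every $b$ with $\varphi(N,b)\neq\emptyset$. The theory $T$ uniformly weakly eliminates imaginaries if for each model $\mathcal N$ of $T$ and each $\emptyset$-definable equivalence relation $E$ on a finite product of sorts of $\mathcal N$ there are formulas $\varphi(x,z)$ and $\psi(x,z)$ such that, for each $a$, the set $X_a=\psi(a,N)$ is finite and non-empty and, for all $c$, $\varphi(N,c)=E(a,N)$ if and only if $c\in X_a$. Then, for every model $\mathcal N$ of $T_{POVS}$: 1. every set definable with parameters in $\mathcal N$, in any finite product of sorts, is weakly coded; 2. for every formula $\varphi(x,z)$ such that at least one variable of the tuple $x$ is of the home sort, the family $(\varphi(N,b))_b$ is uniformly weakly coded; 3. for every formula $\varphi(x,z)$, the family $(\varphi(N,b))_b$ is uniformly weakly coded on non-empty sets. Moreover,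 $T_{POVS}$ uniformly weakly eliminates imaginaries. -/

import Mathlib

universe w u v u₁ v₁

namespace POVS

/-- Terms of the home sort in `m` home-sort variables, in the language
`{+, <, 0, 1, (x ↦ α x)}` with one unary function symbol for each `α : F`. -/
inductive HomeTerm (F : Type w) (m : ℕ) : Type w
  | var : Fin m → HomeTerm F m
  | zero : HomeTerm F m
  | one : HomeTerm F m
  | add : HomeTerm F m → HomeTerm F m → HomeTerm F m
  | smul : F → HomeTerm F m → HomeTerm F m

/-- Terms of the quotient sort in `m` home-sort and `n` quotient-sort variables: they are built
with `π` (applied to home-sort terms), `+_Q` and the scalar multiplications `α_Q`. -/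
inductive QuotTerm (F : Type w) (m n : ℕ) : Type w
  | var : Fin n → QuotTerm F m n
  | proj : HomeTerm F m → QuotTerm F m n
  | add : QuotTerm F m n → QuotTerm F m n → QuotTerm F m n
  | smul : F → QuotTerm F m n → QuotTerm F m n

/-- First-order formulas of the two-sorted language `L*` whose free variables are among `m`
home-sort variables and `n` quotient-sort variables. A quantifier binds the last variable of its
sort. The other connectives and the existential quantifiers are the usual abbreviations. -/
inductive Formula (F : Type w) : ℕ → ℕ → Type w
  | falsum {m n : ℕ} : Formula F m n
  | eqHome {m n : ℕ} : HomeTerm F m → HomeTerm F m → Formula F m n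
  | lt {m n : ℕ} : HomeTerm F m → HomeTerm F m → Formula F m n
  | memQ {m n : ℕ} : HomeTerm F m → Formula F m n
  | eqQuot {m n : ℕ} : QuotTerm F m n → QuotTerm F m n → Formula F m n
  | imp {m n : ℕ} : Formula F m n → Formula F m n → Formula F m n
  | allHome {m n : ℕ} : Formula F (m + 1) n → Formula F m n
  | allQuot {m n : ℕ} : Formula F m (n + 1) → Formula F m n

/-- A sentence is a formula without free variables. -/
abbrev Sentence (F : Type w) : Type w := Formula F 0 0

/-- Arbitrary two-sorted `L*`-structures (no axioms are imposed on the symbols). -/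
structure LStructure (F : Type w) where
  /-- the home sort -/
  Home : Type u
  /-- the quotient sort -/
  Quo : Type v
  zero : Home
  one : Home
  add : Home → Home → Home
  smul : F → Home → Home
  lt : Home → Home → Prop
  memQ : Home → Prop
  proj : Home → Quo
  addQ : Quo → Quo → Quo
  smulQ : F → Quo → Quo

namespace LStructure

variable {F : Type w} (N : LStructure.{w, u, v} F)

/-- Value of a home-sort term. -/
def evalHome {m : ℕ} (x : Fin m → N.Home) : HomeTerm F m → N.Home
  | .var i => x i
  | .zero => N.zero
  | .one => N.one
  | .add s t => N.add (evalHome x s) (evalHome x t)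
  | .smul a t => N.smul a (evalHome x t)

/-- Value of a quotient-sort term. -/
def evalQuot {m n : ℕ} (x : Fin m → N.Home) (y : Fin n → N.Quo) : QuotTerm F m n → N.Quo
  | .var i => y i
  | .proj t => N.proj (N.evalHome x t)
  | .add s t => N.addQ (evalQuot x y s) (evalQuot x y t)
  | .smul a t => N.smulQ a (evalQuot x y t)

/-- Satisfaction of a formula under an assignment of its free variables. -/
def Sat : {m n : ℕ} → Formula F m n → (Fin m → N.Home) → (Fin n → N.Quo) → Prop
  | _, _, .falsum, _, _ => False
  | _, _, .eqHome s t, x, _ => N.evalHome x s = N.evalHome x t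
  | _, _, .lt s t, x, _ => N.lt (N.evalHome x s) (N.evalHome x t)
  | _, _, .memQ t, x, _ => N.memQ (N.evalHome x t)
  | _, _, .eqQuot s t, x, y => N.evalQuot x y s = N.evalQuot x y t
  | _, _, .imp φ ψ, x, y => Sat φ x y → Sat ψ x y
  | _, _, .allHome φ, x, y => ∀ a : N.Home, Sat φ (Fin.snoc x a) y
  | _, _, .allQuot φ, x, y => ∀ a : N.Quo, Sat φ x (Fin.snoc y a)

/-- The complete theory of a structure. -/
def theory : Set (Sentence F) :=
  {φ | N.Sat φ Fin.elim0 Fin.elim0}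

/-- `N` is a model of the set of sentences `T`. -/
def Models (T : Set (Sentence F)) : Prop :=
  ∀ φ ∈ T, N.Sat φ Fin.elim0 Fin.elim0

/-- The product of sorts `Home ^ m × Quo ^ n`. Every finite tuple of sorts is of this form after
reordering its entries. -/
abbrev Tuple (m n : ℕ) : Type (max u v) := (Fin m → N.Home) × (Fin n → N.Quo)

/-- Satisfaction of a formula `φ(x, y)` whose variables are split into two (mixed) tuples. -/
def Sat₂ {m n k l : ℕ} (φ : Formula F (m + k) (n + l)) (a : N.Tuple m n) (b : N.Tuple k l) :
    Prop :=
  N.Sat φ (Fin.append a.1 b.1) (Fin.append a.2 b.2)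

/-- The set `φ(N, b) = {a | N ⊨ φ(a, b)}`. -/
def leftFiber {m n k l : ℕ} (φ : Formula F (m + k) (n + l)) (b : N.Tuple k l) :
    Set (N.Tuple m n) :=
  {a | N.Sat₂ φ a b}

/-- The set `φ(a, N) = {b | N ⊨ φ(a, b)}`. -/
def rightFiber {m n k l : ℕ} (φ : Formula F (m + k) (n + l)) (a : N.Tuple m n) :
    Set (N.Tuple k l) :=
  {b | N.Sat₂ φ a b}

/-- The finite non-empty set `Y` of tuples weakly codes the set `S` via the formula `ψ(x, y)`:
the tuples `c` with `ψ(N, c) = S` are exactly the members of `Y`. -/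
def WeaklyCodes {m n k l : ℕ} (Y : Set (N.Tuple k l)) (ψ : Formula F (m + k) (n + l))
    (S : Set (N.Tuple m n)) : Prop :=
  Y.Finite ∧ Y.Nonempty ∧ ∀ c : N.Tuple k l, N.leftFiber ψ c = S ↔ c ∈ Y

/-- The set `S` is weakly coded. -/
def WeaklyCoded {m n : ℕ} (S : Set (N.Tuple m n)) : Prop :=
  ∃ (k l : ℕ) (ψ : Formula F (m + k) (n + l)) (Y : Set (N.Tuple k l)), N.WeaklyCodes Y ψ S

/-- The sets `φ(N, b)` are uniformly weakly coded: there are formulas `ψ(x, y)` and `χ(y, z)` such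
that, for every `b`, the set `χ(N, b)` is finite and non-empty and weakly codes `φ(N, b)` via
`ψ`. -/
def UniformlyWeaklyCoded {m n k l : ℕ} (φ : Formula F (m + k) (n + l)) : Prop :=
  ∃ (k' l' : ℕ) (ψ : Formula F (m + k') (n + l')) (χ : Formula F (k' + k) (l' + l)),
    ∀ b : N.Tuple k l, N.WeaklyCodes (N.leftFiber χ b) ψ (N.leftFiber φ b)

/-- As `UniformlyWeaklyCoded`, but only the non-empty sets of the family `φ(N, b)` are required to
be coded. -/
def UniformlyWeaklyCodedOnNonempty {m n k l : ℕ} (φ : Formula F (m + k) (n + l)) : Prop :=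
  ∃ (k' l' : ℕ) (ψ : Formula F (m + k') (n + l')) (χ : Formula F (k' + k) (l' + l)),
    ∀ b : N.Tuple k l, (N.leftFiber φ b).Nonempty →
      N.WeaklyCodes (N.leftFiber χ b) ψ (N.leftFiber φ b)

end LStructure

/-- The theory `T` uniformly weakly eliminates imaginaries: for each model `N` of `T` and each
equivalence relation `E` on a product of sorts that is definable without parameters, there are
formulas `φ(x, z)` and `ψ(x, z)` such that for each `a` the set `X_a = ψ(a, N)` is finite and
non-empty and consists of exactly those `c` with `φ(N, c) = E(a, N)`. -/
def UniformlyWeaklyEliminatesImaginaries {F : Type w} (T : Set (Sentence F)) : Prop :=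
  ∀ (m n : ℕ) (E : Formula F (m + m) (n + n)) (N : LStructure.{w, u, v} F), N.Models T →
    Equivalence (fun a b : N.Tuple m n => N.Sat₂ E a b) →
    ∃ (k l : ℕ) (φ ψ : Formula F (m + k) (n + l)),
      ∀ a : N.Tuple m n, N.WeaklyCodes (N.rightFiber ψ a) φ (N.rightFiber E a)

section Standard

variable {F : Type w} {M : Type u} [Field F] [LinearOrder F] [IsStrictOrderedRing F]
  [AddCommGroup M] [LinearOrder M] [IsOrderedAddMonoid M] [Module F M] [IsStrictOrderedModule F M]

/-- `Q` is (the universe of) a proper dense substructure of the ordered vector space `M` with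
distinguished positive element `e`. -/
structure IsDensePair (Q : Submodule F M) (e : M) : Prop where
  pos : 0 < e
  mem : e ∈ Q
  ne_top : Q ≠ ⊤
  dense : ∀ a b : M, a < b → ∃ q ∈ Q, a < q ∧ q < b

/-- The two-sorted structure `(M, M / Q; +, <, 0, e, (x ↦ α x), Q, π, +_Q, (x ↦ α_Q x))`. -/
def standard (Q : Submodule F M) (e : M) : LStructure.{w, u, u} F where
  Home := M
  Quo := M ⧸ Q
  zero := 0
  one := e
  add x y := x + y
  smul a x := a • x
  lt x y := x < y
  memQ x := x ∈ Q
  proj x := Q.mkQ x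
  addQ x y := x + y
  smulQ a x := a • x

/-- The theory `T_POVS`, as the complete theory of the two-sorted structure on `(M, M / Q)`. -/
def TPOVS (Q : Submodule F M) (e : M) : Set (Sentence F) :=
  (standard Q e).theory

end Standard

end POVS

set_option linter.unusedSectionVars false

/-! A model amounts to an `F`-linear surjection `π : V → W` from an ordered vector space, with
proper dense kernel. Whether a quantifier-free condition holds at `a` depends only on the order
position and the coset of `a` relative to finitely many terms in the other variables. By density
every interval meets every coset, so position and coset can be prescribed independently; this gives
quantifier elimination (`QFDef.exists_opt`), quotient variables being images of home variables.
Hence in a definable family of subsets of `V` each member is governed by a bounded number of points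
(`Tame`), and with one more home parameter `u` by a bounded number of lines in `u` whose slopes are
the same for the whole family (`Dfn.exists_lines`).

The heart is a canonical finite choice (`Dfn.choosable`). To each nonempty member `S b` of a
definable family one attaches, depending only on the set `S b`, a finite nonempty set of tuples `c`,
each defining a nonempty subset `ψ c` of `S b`. For the classes of an equivalence relation such
tuples are weak codes: classes are disjoint, so the nonempty set `ψ c` determines the class that
contains it (`Dfn.exists_codes`).

For subsets of `V`, the choice is made at or immediately to the right of the infimum, after
splitting at `0`. For subsets of `V ^ (n + 1)`, choose by induction in the fibers over the first
coordinate `u`. The parameters so obtained form a set of pairs `(u, c)` with finite fibers over `V`.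
Finiteness forces the coordinates of `c` onto finitely many lines in `u`, and they are removed one
at a time (`choosable_of_lines`): either some line contains many points of the set, and the finitely
many such lines can be chosen, or the coordinate takes only finitely many values. -/

namespace POVS

/-! ### Terms, quantifier-free sets and their isolated atoms -/

section Pair

variable {F : Type w} [Field F] [LinearOrder F] [IsStrictOrderedRing F]
  {V : Type u} [AddCommGroup V] [LinearOrder V] [IsOrderedAddMonoid V]
  [Module F V] [IsStrictOrderedModule F V]
  {W : Type v} [AddCommGroup W] [Module F W]

/-- The functions `V ^ ι → V` given by terms of the language of ordered vector spaces with a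
distinguished element `e`. -/
inductive AffineFn (F : Type w) [Field F] [Module F V] (e : V) {ι : Type} : ((ι → V) → V) → Prop
  | coord (i : ι) : AffineFn F e (fun x => x i)
  | const : AffineFn F e (fun _ => e)
  | zero : AffineFn F e (fun _ => 0)
  | add {f g : (ι → V) → V} : AffineFn F e f → AffineFn F e g → AffineFn F e (fun x => f x + g x)
  | smul (a : F) {f : (ι → V) → V} : AffineFn F e f → AffineFn F e (fun x => a • f x)

/-- The sets defined by quantifier-free formulas in home-sort variables. -/
inductive QFDef (π : V →ₗ[F] W) (e : V) {ι : Type} : ((ι → V) → Prop) → Prop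
  | pos {f : (ι → V) → V} : AffineFn F e f → QFDef π e (fun x => 0 < f x)
  | ker {f : (ι → V) → V} : AffineFn F e f → QFDef π e (fun x => π (f x) = 0)
  | not {P : (ι → V) → Prop} : QFDef π e P → QFDef π e (fun x => ¬ P x)
  | and {P R : (ι → V) → Prop} : QFDef π e P → QFDef π e R → QFDef π e (fun x => P x ∧ R x)

/-- The linear map `π` has a proper dense kernel, is onto, and `e` is positive. -/
structure DensePair (π : V →ₗ[F] W) (e : V) : Prop where
  pos : 0 < e
  surj : Function.Surjective π
  ne_zero : ∃ v, π v ≠ 0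
  dense : ∀ a b : V, a < b → ∃ c, π c = 0 ∧ a < c ∧ c < b

variable {π : V →ₗ[F] W} {e : V} {ι κ : Type}

/-- Extend an assignment of `ι` by a value of the extra variable. -/
def optCons (a : V) (x : ι → V) : Option ι → V := fun o => o.elim a x

namespace AffineFn

theorem neg {f : (ι → V) → V} (hf : AffineFn F e f) : AffineFn F e (fun x => - f x) := by
  simpa using hf.smul (-1)

theorem sub {f g : (ι → V) → V} (hf : AffineFn F e f) (hg : AffineFn F e g) :
    AffineFn F e (fun x => f x - g x) := by
  simpa [sub_eq_add_neg] using hf.add hg.neg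

theorem comp {f : (ι → V) → V} (hf : AffineFn F e f) {G : (κ → V) → ι → V}
    (hG : ∀ i, AffineFn F e (fun x => G x i)) : AffineFn F e (fun x => f (G x)) := by
  induction hf with
  | coord i => exact hG i
  | const => exact .const
  | zero => exact .zero
  | add _ _ h₁ h₂ => exact h₁.add h₂
  | smul a _ h => exact h.smul a

theorem exists_slope {f : (Option ι → V) → V} (hf : AffineFn F e f) :
    ∃ (α : F) (g : (ι → V) → V), AffineFn F e g ∧ ∀ a x, f (optCons a x) = α • a + g x := by
  induction hf with
  | coord i =>
    cases i with
    | none => exact ⟨1, _, .zero, fun a x => by simp [optCons]⟩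
    | some i => exact ⟨0, _, .coord i, fun a x => by simp [optCons]⟩
  | const => exact ⟨0, _, .const, fun a x => by simp⟩
  | zero => exact ⟨0, _, .zero, fun a x => by simp⟩
  | add _ _ h₁ h₂ =>
    obtain ⟨α, g, hg, h⟩ := h₁
    obtain ⟨α', g', hg', h'⟩ := h₂
    exact ⟨α + α', _, hg.add hg', fun a x => by simp only [h, h', add_smul]; abel⟩
  | smul c _ h =>
    obtain ⟨α, g, hg, h⟩ := h
    exact ⟨c * α, _, hg.smul c, fun a x => by simp only [h, smul_add, mul_smul]⟩

end AffineFn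

namespace QFDef

theorem congr {P R : (ι → V) → Prop} (h : QFDef π e P) (hPR : ∀ x, R x ↔ P x) :
    QFDef π e R := by
  have : R = P := funext fun x => propext (hPR x)
  exact this ▸ h

theorem or {P R : (ι → V) → Prop} (hP : QFDef π e P) (hR : QFDef π e R) :
    QFDef π e (fun x => P x ∨ R x) :=
  (hP.not.and hR.not).not.congr fun x => by tauto

theorem falsum : QFDef π e (fun _ : ι → V => False) :=
  (QFDef.pos .zero).congr fun x => by simp

theorem verum : QFDef π e (fun _ : ι → V => True) :=
  falsum.not.congr fun x => by simp

theorem prop (p : Prop) : QFDef π e (fun _ : ι → V => p) := by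
  by_cases h : p
  · exact verum.congr fun x => by simp [h]
  · exact falsum.congr fun x => by simp [h]

theorem lt {f g : (ι → V) → V} (hf : AffineFn F e f) (hg : AffineFn F e g) :
    QFDef π e (fun x => f x < g x) :=
  (QFDef.pos (hg.sub hf)).congr fun x => by simp

theorem eq {f g : (ι → V) → V} (hf : AffineFn F e f) (hg : AffineFn F e g) :
    QFDef π e (fun x => f x = g x) :=
  ((lt hf hg).not.and (lt hg hf).not).congr fun x => by
    rw [not_lt, not_lt, le_antisymm_iff, and_comm]

theorem proj_eq {f g : (ι → V) → V} (hf : AffineFn F e f) (hg : AffineFn F e g) :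
    QFDef π e (fun x => π (f x) = π (g x)) :=
  (QFDef.ker (hf.sub hg)).congr fun x => by simp [sub_eq_zero]

theorem comp {P : (ι → V) → Prop} (hP : QFDef π e P) {G : (κ → V) → ι → V}
    (hG : ∀ i, AffineFn F e (fun x => G x i)) : QFDef π e (fun x => P (G x)) := by
  induction hP with
  | pos hf => exact .pos (hf.comp hG)
  | ker hf => exact .ker (hf.comp hG)
  | not _ h => exact h.not
  | and _ _ h₁ h₂ => exact h₁.and h₂

theorem exists_mem_list {α : Type*} (l : List α) {P : α → (ι → V) → Prop}
    (h : ∀ a ∈ l, QFDef π e (P a)) : QFDef π e (fun x => ∃ a ∈ l, P a x) := by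
  induction l with
  | nil => exact falsum.congr fun x => by simp
  | cons a l ih =>
    refine ((h a (by simp)).or (ih fun b hb => h b (by simp [hb]))).congr fun x => by simp

theorem forall_finite {α : Type*} [Finite α] {P : α → (ι → V) → Prop}
    (h : ∀ a, QFDef π e (P a)) : QFDef π e (fun x => ∀ a, P a x) := by
  classical
  have := Fintype.ofFinite α
  refine (exists_mem_list (Finset.univ : Finset α).toList fun a _ => (h a).not).not.congr
    fun x => by simp

end QFDef

/-- `y` and `y'` lie on the same side of `t` and in the same way in or outside of its coset. -/
def SameType (π : V →ₗ[F] W) (t y y' : V) : Prop :=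
  (y < t ↔ y' < t) ∧ (t < y ↔ t < y') ∧ (π y = π t ↔ π y' = π t)

/-- Induction on quantifier-free predicates, with one variable singled out and isolated in the
atoms. -/
theorem QFDef.opt_induction {M : (V → (ι → V) → Prop) → Prop}
    (const : ∀ R, QFDef π e R → M (fun _ x => R x))
    (lt : ∀ h, AffineFn F e h → M (fun a x => a < h x))
    (gt : ∀ h, AffineFn F e h → M (fun a x => h x < a))
    (coset : ∀ h, AffineFn F e h → M (fun a x => π a = π (h x)))
    (not : ∀ P, M P → M (fun a x => ¬ P a x))
    (and : ∀ P R, M P → M R → M (fun a x => P a x ∧ R a x))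
    {P : (Option ι → V) → Prop} (hP : QFDef π e P) : M (fun a x => P (optCons a x)) := by
  induction hP with
  | pos hf =>
    -- The atom is `0 < α • a + g x`. For `α ≠ 0` it compares `a` with `-(α⁻¹ • g x)`, in a
    -- direction that depends on the sign of `α`.
    obtain ⟨α, g, hg, h⟩ := hf.exists_slope
    simp only [h]
    rcases lt_trichotomy α 0 with hα | hα | hα
    · convert lt _ (hg.smul α⁻¹).neg using 3 with c x
      rw [← smul_lt_smul_iff_of_neg_left hα (b₂ := c), smul_neg, smul_smul,
        mul_inv_cancel₀ hα.ne, one_smul, neg_lt_iff_pos_add]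
    · simpa [hα] using const _ (.pos hg)
    · convert gt _ (hg.smul α⁻¹).neg using 3 with c x
      rw [← smul_lt_smul_iff_of_pos_left hα (b₂ := c), smul_neg, smul_smul,
        mul_inv_cancel₀ hα.ne', one_smul, neg_lt_iff_pos_add]
  | ker hf =>
    obtain ⟨α, g, hg, h⟩ := hf.exists_slope
    simp only [h]
    rcases eq_or_ne α 0 with hα | hα
    · simpa [hα] using const _ (.ker hg)
    · convert coset _ (hg.smul α⁻¹).neg using 3 with c x
      rw [map_add, map_smul, map_neg, map_smul, ← (smul_right_injective W hα).eq_iff (a := π c),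
        smul_neg, smul_smul, mul_inv_cancel₀ hα, one_smul, eq_neg_iff_add_eq_zero]
  | not _ h => exact not _ h
  | and _ _ h₁ h₂ => exact and _ _ h₁ h₂

theorem QFDef.exists_terms {P : (Option ι → V) → Prop} (hP : QFDef π e P) :
    ∃ T : List ((ι → V) → V), (∀ t ∈ T, AffineFn F e t) ∧
      ∀ x a a', (∀ t ∈ T, SameType π (t x) a a') → (P (optCons a x) ↔ P (optCons a' x)) := by
  refine hP.opt_induction (M := fun P => ∃ T : List ((ι → V) → V), (∀ t ∈ T, AffineFn F e t) ∧
      ∀ x a a', (∀ t ∈ T, SameType π (t x) a a') → (P a x ↔ P a' x)) ?_ ?_ ?_ ?_ ?_ ?_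
  · exact fun R _ => ⟨[], by simp, by simp⟩
  · exact fun h hh => ⟨[h], by simpa, fun x a a' hT => (hT h (by simp)).1⟩
  · exact fun h hh => ⟨[h], by simpa, fun x a a' hT => (hT h (by simp)).2.1⟩
  · exact fun h hh => ⟨[h], by simpa, fun x a a' hT => (hT h (by simp)).2.2⟩
  · rintro P ⟨T, hT, h⟩
    exact ⟨T, hT, fun x a a' hx => not_congr (h x a a' hx)⟩
  · rintro P R ⟨T₁, hT₁, h₁⟩ ⟨T₂, hT₂, h₂⟩
    refine ⟨T₁ ++ T₂, fun t ht => ?_, fun x a a' hx => and_congr (h₁ x a a' fun t ht => ?_)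
      (h₂ x a a' fun t ht => ?_)⟩
    · rcases List.mem_append.1 ht with ht | ht
      exacts [hT₁ t ht, hT₂ t ht]
    · exact hx t (by simp [ht])
    · exact hx t (by simp [ht])

/-- Translation by a preimage of `q` turns density of the kernel into density of every coset. -/
theorem DensePair.exists_between (h : DensePair π e) {a b : V} (hab : a < b) (q : W) :
    ∃ c, π c = q ∧ a < c ∧ c < b := by
  obtain ⟨v, rfl⟩ := h.surj q
  obtain ⟨c, hc, h₁, h₂⟩ := h.dense (a - v) (b - v) (by simpa)
  exact ⟨c + v, by simp [hc], sub_lt_iff_lt_add.1 h₁, lt_sub_iff_add_lt.1 h₂⟩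

theorem DensePair.infinite (h : DensePair π e) : Infinite W := by
  obtain ⟨v, hv⟩ := h.ne_zero
  exact Infinite.of_injective (fun n : ℕ => (n : F) • π v) fun n m hnm => by
    simpa using smul_left_injective F hv hnm

/-! ### Virtual points and quantifier elimination -/

/-- `P a` holds for all `a` sufficiently close to `t` on the side given by the sign `σ` and
with `π a` in a small set of the filter `co`. -/
def Near (π : V →ₗ[F] W) (σ : ℤˣ) (co : Filter W) (t : V) (P : V → Prop) : Prop :=
  ∃ δ > 0, ∃ U ∈ co, ∀ a, 0 < σ • (a - t) → σ • (a - t) < δ → π a ∈ U → P a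

namespace Near

variable {σ : ℤˣ} {co : Filter W} {t : V} {P R : V → Prop}

theorem and (hP : Near π σ co t P) (hR : Near π σ co t R) :
    Near π σ co t (fun a => P a ∧ R a) := by
  obtain ⟨δ, hδ, U, hU, h⟩ := hP
  obtain ⟨δ', hδ', U', hU', h'⟩ := hR
  refine ⟨min δ δ', lt_min hδ hδ', U ∩ U', Filter.inter_mem hU hU', fun a h0 hlt ha => ?_⟩
  exact ⟨h a h0 (hlt.trans_le (min_le_left _ _)) ha.1,
    h' a h0 (hlt.trans_le (min_le_right _ _)) ha.2⟩

theorem mono (hP : Near π σ co t P) (h : ∀ a, P a → R a) : Near π σ co t R := by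
  obtain ⟨δ, hδ, U, hU, h'⟩ := hP
  exact ⟨δ, hδ, U, hU, fun a h0 hlt ha => h a (h' a h0 hlt ha)⟩

theorem of_forall (hp : DensePair π e) (h : ∀ a, P a) : Near π σ co t P :=
  ⟨e, hp.pos, Set.univ, Filter.univ_mem, fun a _ _ _ => h a⟩

theorem forall_mem_list (hp : DensePair π e) {α : Type*} (l : List α) {P : α → V → Prop}
    (h : ∀ i ∈ l, Near π σ co t (P i)) : Near π σ co t (fun a => ∀ i ∈ l, P i a) := by
  induction l with
  | nil => exact of_forall hp (by simp)
  | cons i l ih =>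
    exact ((h i (by simp)).and (ih fun j hj => h j (by simp [hj]))).mono fun a ha => by
      simpa using ha

theorem of_eventually (hp : DensePair π e) {U : W → Prop} (h : ∀ᶠ q in co, U q) :
    Near π σ co t (fun a => U (π a)) :=
  ⟨e, hp.pos, _, h, fun _ _ _ ha => ha⟩

theorem side (hp : DensePair π e) : Near π σ co t (fun a => 0 < σ • (a - t)) :=
  ⟨e, hp.pos, _, Filter.univ_mem, fun _ ha _ _ => ha⟩

theorem lt_of_lt {b : V} (h : t < b) : Near π σ co t (fun a => a < b) := by
  refine ⟨b - t, sub_pos.2 h, _, Filter.univ_mem, fun a h0 h1 _ => ?_⟩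
  rcases Int.units_eq_one_or σ with rfl | rfl
  · simpa using h1
  · have : a < t := by simpa [Units.smul_def] using h0
    exact this.trans h

theorem gt_of_gt {b : V} (h : b < t) : Near π σ co t (fun a => b < a) := by
  refine ⟨t - b, sub_pos.2 h, _, Filter.univ_mem, fun a h0 h1 _ => ?_⟩
  rcases Int.units_eq_one_or σ with rfl | rfl
  · have : t < a := by simpa using h0
    exact h.trans this
  · simpa [Units.smul_def] using h1

/-- Virtual points are approximated by real ones: a member of the filter supplies a coset, `δ`
supplies an interval next to `t`, and the two meet by density. -/
theorem exists_point (hp : DensePair π e) [co.NeBot] (hP : Near π σ co t P) : ∃ a, P a := by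
  obtain ⟨δ, hδ, U, hU, h⟩ := hP
  obtain ⟨q, hq⟩ := Filter.nonempty_of_mem hU
  rcases Int.units_eq_one_or σ with rfl | rfl
  · obtain ⟨a, ha, h1, h2⟩ := hp.exists_between (lt_add_of_pos_right t hδ) q
    exact ⟨a, h a (by simpa using h1) (by simpa [sub_lt_iff_lt_add'] using h2) (ha ▸ hq)⟩
  · obtain ⟨a, ha, h1, h2⟩ := hp.exists_between (sub_lt_self t hδ) q
    exact ⟨a, h a (by simpa [Units.smul_def] using h2)
      (by simpa [Units.smul_def, sub_lt_comm] using h1) (ha ▸ hq)⟩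

end Near

/-- Quantifier-free predicates have a quantifier-free decidable truth value at virtual points. -/
theorem QFDef.near (hp : DensePair π e) (σ : ℤˣ) {co : (ι → V) → Filter W} {t : (ι → V) → V}
    (ht : AffineFn F e t)
    (hco : ∀ h, AffineFn F e h → ∃ R, QFDef π e R ∧ ∀ x, (R x → ∀ᶠ q in co x, q = π (h x)) ∧
      (¬ R x → ∀ᶠ q in co x, ¬ q = π (h x)))
    {P : (Option ι → V) → Prop} (hP : QFDef π e P) :
    ∃ R, QFDef π e R ∧ ∀ x, (R x → Near π σ (co x) (t x) fun a => P (optCons a x)) ∧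
      (¬ R x → Near π σ (co x) (t x) fun a => ¬ P (optCons a x)) := by
  refine hP.opt_induction (M := fun P => ∃ R, QFDef π e R ∧ ∀ x,
    (R x → Near π σ (co x) (t x) fun a => P a x) ∧
      (¬ R x → Near π σ (co x) (t x) fun a => ¬ P a x)) ?_ ?_ ?_ ?_ ?_ ?_
  · exact fun R hR => ⟨R, hR, fun x => ⟨fun h => .of_forall hp fun _ => h,
      fun h => .of_forall hp fun _ => h⟩⟩
  · intro h hh
    -- A point arbitrarily close to `t x` on the side `σ` lies below `h x` if `t x` does; in case of
    -- equality the side decides.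
    refine ⟨fun x => t x < h x ∨ t x = h x ∧ σ = -1,
      (QFDef.lt ht hh).or ((QFDef.eq ht hh).and (.prop _)), fun x => ⟨?_, ?_⟩⟩
    · rintro (h1 | ⟨h1, rfl⟩)
      · exact .lt_of_lt h1
      · exact (Near.side hp).mono fun a ha => by simpa [Units.smul_def, h1] using ha
    · intro h1
      rcases lt_trichotomy (t x) (h x) with h2 | h2 | h2
      · exact absurd (Or.inl h2) h1
      · rcases Int.units_eq_one_or σ with rfl | rfl
        · exact (Near.side hp).mono fun a ha => by
            have : h x < a := by simpa [h2] using ha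
            exact this.not_gt
        · exact absurd (Or.inr ⟨h2, rfl⟩) h1
      · exact (Near.gt_of_gt h2).mono fun a ha => ha.not_gt
  · intro h hh
    refine ⟨fun x => h x < t x ∨ t x = h x ∧ σ = 1,
      (QFDef.lt hh ht).or ((QFDef.eq ht hh).and (.prop _)), fun x => ⟨?_, ?_⟩⟩
    · rintro (h1 | ⟨h1, rfl⟩)
      · exact .gt_of_gt h1
      · exact (Near.side hp).mono fun a ha => by simpa [h1] using ha
    · intro h1
      rcases lt_trichotomy (h x) (t x) with h2 | h2 | h2
      · exact absurd (Or.inl h2) h1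
      · rcases Int.units_eq_one_or σ with rfl | rfl
        · exact absurd (Or.inr ⟨h2.symm, rfl⟩) h1
        · exact (Near.side hp).mono fun a ha => by
            have : a < h x := by simpa [Units.smul_def, h2] using ha
            exact this.not_gt
      · exact (Near.lt_of_lt h2).mono fun a ha => ha.not_gt
  · intro h hh
    obtain ⟨R, hR, h'⟩ := hco h hh
    exact ⟨R, hR, fun x => ⟨fun hx => .of_eventually hp ((h' x).1 hx),
      fun hx => .of_eventually hp ((h' x).2 hx)⟩⟩
  · rintro P ⟨R, hR, h⟩
    exact ⟨_, hR.not, fun x => ⟨(h x).2, fun hx => by simpa using (h x).1 (not_not.1 hx)⟩⟩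
  · rintro P P' ⟨R, hR, h⟩ ⟨R', hR', h'⟩
    refine ⟨_, hR.and hR', fun x => ⟨fun hx => ((h x).1 hx.1).and ((h' x).1 hx.2), fun hx => ?_⟩⟩
    by_cases hx' : R x
    · exact ((h' x).2 fun h => hx ⟨hx', h⟩).mono fun a ha h => ha h.2
    · exact ((h x).2 hx').mono fun a ha h => ha h.1

/-- As `co x` is a proper filter, `P` and its negation cannot both hold near `t x`, so the predicate
found in `QFDef.near` is the truth value itself. -/
theorem QFDef.near_iff (hp : DensePair π e) (σ : ℤˣ) {co : (ι → V) → Filter W}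
    [∀ x, (co x).NeBot] {t : (ι → V) → V} (ht : AffineFn F e t)
    (hco : ∀ h, AffineFn F e h → ∃ R, QFDef π e R ∧ ∀ x, (R x → ∀ᶠ q in co x, q = π (h x)) ∧
      (¬ R x → ∀ᶠ q in co x, ¬ q = π (h x)))
    {P : (Option ι → V) → Prop} (hP : QFDef π e P) :
    QFDef π e (fun x => Near π σ (co x) (t x) fun a => P (optCons a x)) := by
  obtain ⟨R, hR, h⟩ := QFDef.near hp σ ht hco hP
  refine hR.congr fun x => ⟨fun hx => ?_, (h x).1⟩
  by_contra hRx
  obtain ⟨a, ha, ha'⟩ := (hx.and ((h x).2 hRx)).exists_point hp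
  exact ha' ha

theorem QFDef.near_coset (hp : DensePair π e) (σ : ℤˣ) {s t : (ι → V) → V}
    (ht : AffineFn F e t) (hs : AffineFn F e s) {P : (Option ι → V) → Prop} (hP : QFDef π e P) :
    QFDef π e (fun x => Near π σ (pure (π (s x))) (t x) fun a => P (optCons a x)) :=
  near_iff hp σ ht (fun _ hh => ⟨_, .proj_eq hs hh, fun _ => ⟨fun h => by simpa using h,
    fun h => by simpa using h⟩⟩) hP

/-- The cofinite filter plays the role of a coset different from all those given by terms. It is
proper because `W` is infinite. -/
theorem QFDef.near_generic (hp : DensePair π e) (σ : ℤˣ) {t : (ι → V) → V}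
    (ht : AffineFn F e t) {P : (Option ι → V) → Prop} (hP : QFDef π e P) :
    QFDef π e (fun x => Near π σ Filter.cofinite (t x) fun a => P (optCons a x)) :=
  have := hp.infinite
  near_iff hp σ (co := fun _ => Filter.cofinite) ht (fun h _ => ⟨_, falsum, fun x =>
    ⟨False.elim, fun _ => Filter.eventually_cofinite_ne (π (h x))⟩⟩) hP

/-- A point outside of a nonempty finite set is next to one of the members of the set. -/
theorem exists_adjacent (hp : DensePair π e) {T : List V} (hT : T ≠ []) {a : V} (ha : a ∉ T) :
    ∃ t ∈ T, ∃ σ : ℤˣ, ∀ (co : Filter W), ∀ s ∈ T,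
      Near π σ co t (fun a' => (a' < s ↔ a < s) ∧ (s < a' ↔ s < a)) := by
  have hne : ∀ s ∈ T, s ≠ a := fun s hs h => ha (h ▸ hs)
  -- The neighbor is the largest member below `a`, approached from the right, or, if there is none,
  -- the least member, approached from the left.
  by_cases h : ∃ t ∈ T, t < a
  · obtain ⟨t, ht, hta⟩ := h
    obtain ⟨m, hm, hmax⟩ := (T.toFinset.filter (· < a)).exists_max_image id ⟨t, by simp [ht, hta]⟩
    simp only [Finset.mem_filter, List.mem_toFinset, id] at hm hmax
    refine ⟨m, hm.1, 1, fun co s hs => ?_⟩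
    rcases (hne s hs).lt_or_gt with hsa | hsa
    · refine (Near.side hp).mono fun a' ha' => ?_
      have : s < a' := (hmax s ⟨hs, hsa⟩).trans_lt (by simpa using ha')
      exact ⟨iff_of_false this.not_gt hsa.not_gt, iff_of_true this hsa⟩
    · exact (Near.lt_of_lt (hm.2.trans hsa)).mono fun a' ha' =>
        ⟨iff_of_true ha' hsa, iff_of_false ha'.not_gt hsa.not_gt⟩
  · push Not at h
    obtain ⟨m, hm, hmin⟩ := T.toFinset.exists_min_image id
      (by simpa [List.toFinset_nonempty_iff] using hT)
    simp only [List.mem_toFinset, id] at hm hmin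
    refine ⟨m, hm, -1, fun co s hs => (Near.side hp).mono fun a' ha' => ?_⟩
    have h1 : a' < s := lt_of_lt_of_le (by simpa [Units.smul_def] using ha') (hmin s hs)
    have h2 : a < s := lt_of_le_of_ne (h s hs) (hne s hs).symm
    exact ⟨iff_of_true h1 h2, iff_of_false h1.not_gt h2.not_gt⟩

/-- Quantifier elimination for one variable of the home sort. -/
theorem QFDef.exists_opt (hp : DensePair π e) {P : (Option ι → V) → Prop} (hP : QFDef π e P) :
    QFDef π e (fun x => ∃ a, P (optCons a x)) := by
  obtain ⟨T₀, hT₀, hT₀P⟩ := hP.exists_terms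
  -- The additional term makes the list nonempty, as `exists_adjacent` requires.
  let T := (fun _ => 0) :: T₀
  have hT : ∀ t ∈ T, AffineFn F e t := by simpa [T] using ⟨.zero, hT₀⟩
  have hTP : ∀ x a a', (∀ t ∈ T, SameType π (t x) a a') →
      (P (optCons a x) ↔ P (optCons a' x)) :=
    fun x a a' h => hT₀P x a a' fun t ht => h t (by simp [T, ht])
  have hpt : QFDef π e (fun x => ∃ t ∈ T, P (optCons (t x) x)) := by
    refine exists_mem_list T fun t ht => hP.comp fun o => ?_
    cases o with
    | none => exact hT t ht
    | some i => exact .coord i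
  have hco : ∀ σ, QFDef π e (fun x => ∃ t ∈ T, ∃ s ∈ T,
      Near π σ (pure (π (s x))) (t x) fun a => P (optCons a x)) := fun σ =>
    exists_mem_list T fun t ht => exists_mem_list T fun s hs =>
      near_coset hp σ (hT t ht) (hT s hs) hP
  have hgen : ∀ σ, QFDef π e (fun x => ∃ t ∈ T,
      Near π σ Filter.cofinite (t x) fun a => P (optCons a x)) := fun σ =>
    exists_mem_list T fun t ht => near_generic hp σ (hT t ht) hP
  refine (hpt.or (((hco 1).or (hco (-1))).or ((hgen 1).or (hgen (-1))))).congr fun x => ⟨?_, ?_⟩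
  · rintro ⟨a, ha⟩
    -- A witness that is not itself a term can be moved to a virtual point next to a term. The
    -- virtual point lies in the coset of the witness if that is the coset of a term, and in a
    -- generic coset otherwise.
    by_cases haT : a ∈ T.map (fun t => t x)
    · obtain ⟨t, ht, rfl⟩ := List.mem_map.1 haT
      exact .inl ⟨t, ht, ha⟩
    · right
      obtain ⟨t', ht', σ, hσ⟩ := exists_adjacent hp (T := T.map (fun t => t x)) (by simp [T]) haT
      obtain ⟨t, ht, rfl⟩ := List.mem_map.1 ht'
      have key : ∀ co : Filter W, (∀ s ∈ T, ∀ᶠ q in co, (q = π (s x) ↔ π a = π (s x))) →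
          Near π σ co (t x) fun a => P (optCons a x) := fun co hco => by
        refine (Near.forall_mem_list hp T fun s hs =>
          (hσ co (s x) (List.mem_map_of_mem hs)).and (Near.of_eventually hp (hco s hs))).mono
          fun a' ha' => ?_
        exact (hTP x a' a fun s hs => ⟨(ha' s hs).1.1, (ha' s hs).1.2, (ha' s hs).2⟩).2 ha
      by_cases hc : ∃ s ∈ T, π a = π (s x)
      · obtain ⟨s, hs, has⟩ := hc
        have := key (pure (π (s x))) fun s' _ => by simp [has]
        left
        rcases Int.units_eq_one_or σ with rfl | rfl
        · exact .inl ⟨t, ht, s, hs, this⟩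
        · exact .inr ⟨t, ht, s, hs, this⟩
      · push Not at hc
        have := key Filter.cofinite fun s hs => by
          simp [hc s hs]
        right
        rcases Int.units_eq_one_or σ with rfl | rfl
        · exact .inl ⟨t, ht, this⟩
        · exact .inr ⟨t, ht, this⟩
  · have := hp.infinite
    rintro (⟨t, _, h⟩ | (⟨t, _, s, _, h⟩ | ⟨t, _, s, _, h⟩) | (⟨t, _, h⟩ | ⟨t, _, h⟩))
    · exact ⟨_, h⟩
    all_goals exact h.exists_point hp

theorem QFDef.exists_sum (hp : DensePair π e) {P : (ι ⊕ κ → V) → Prop} [Finite κ]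
    (hP : QFDef π e P) : QFDef π e (fun x : ι → V => ∃ y : κ → V, P (Sum.elim x y)) := by
  suffices ∀ κ : Type, Finite κ → ∀ (ι : Type) (P : (ι ⊕ κ → V) → Prop), QFDef π e P →
      QFDef π e (fun x : ι → V => ∃ y : κ → V, P (Sum.elim x y)) from this κ ‹_› ι P hP
  clear hP P
  intro κ hκ
  refine Finite.induction_empty_option (P := fun κ => ∀ (ι : Type) (P : (ι ⊕ κ → V) → Prop),
    QFDef π e P → QFDef π e (fun x : ι → V => ∃ y : κ → V, P (Sum.elim x y))) ?_ ?_ ?_ κ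
  · intro α β f h ι P hP
    refine (h ι (fun z => P fun i => z (i.map id f.symm)) (hP.comp fun i => .coord _)).congr
      fun x => ⟨?_, ?_⟩
    · rintro ⟨y, hy⟩
      refine ⟨y ∘ f, ?_⟩
      convert hy using 2 with i
      cases i <;> simp
    · rintro ⟨y, hy⟩
      refine ⟨y ∘ f.symm, ?_⟩
      convert hy using 2 with i
      cases i <;> simp
  · intro ι P hP
    refine (hP.comp (G := fun x => Sum.elim x PEmpty.elim) fun i => ?_).congr fun x => ⟨?_, ?_⟩
    · rcases i with i | i
      exacts [.coord i, i.elim]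
    · rintro ⟨y, hy⟩
      rwa [Subsingleton.elim y PEmpty.elim] at hy
    · exact fun h => ⟨_, h⟩
  · intro α _ h ι P hP
    have h1 := QFDef.exists_opt hp (ι := ι ⊕ α)
      (P := fun z => P (Sum.elim (fun i => z (some (.inl i)))
        (fun o => z (o.map .inr)))) (hP.comp fun i => by rcases i with i | i <;> exact .coord _)
    refine (h ι _ h1).congr fun x => ⟨?_, ?_⟩
    · rintro ⟨y, hy⟩
      refine ⟨fun a => y (some a), y none, ?_⟩
      refine cast (congrArg P (funext fun o => ?_)) hy
      rcases o with i | _ | i <;> simp [optCons]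
    · rintro ⟨y, a, hy⟩
      refine ⟨optCons a y, ?_⟩
      refine cast (congrArg P (funext fun o => ?_)) hy
      rcases o with i | _ | i <;> simp [optCons]

/-! ### Definable predicates on products of sorts -/

/-- An identification of `X` with a finite product of copies of `V` and `W`. -/
class SortProd (V : Type u) (W : Type v) (X : Type*) where
  /-- the index type of the coordinates in `V` -/
  HIdx : Type
  /-- the index type of the coordinates in `W` -/
  QIdx : Type
  [finite_hIdx : Finite HIdx]
  [finite_qIdx : Finite QIdx]
  /-- the identification -/
  eqv : X ≃ (HIdx → V) × (QIdx → W)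

attribute [instance] SortProd.finite_hIdx SortProd.finite_qIdx

namespace SortProd

instance home : SortProd V W V where
  HIdx := Unit
  QIdx := Empty
  eqv := ⟨fun x => (fun _ => x, Empty.elim), fun p => p.1 (), fun _ => rfl,
    fun _ => Prod.ext rfl (Subsingleton.elim _ _)⟩

instance quo : SortProd V W W where
  HIdx := Empty
  QIdx := Unit
  eqv := ⟨fun x => (Empty.elim, fun _ => x), fun p => p.2 (), fun _ => rfl,
    fun _ => Prod.ext (Subsingleton.elim _ _) rfl⟩

instance unit : SortProd V W Unit where
  HIdx := Empty
  QIdx := Empty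
  eqv := ⟨fun _ => (Empty.elim, Empty.elim), fun _ => (), fun _ => rfl,
    fun _ => Prod.ext (Subsingleton.elim _ _) (Subsingleton.elim _ _)⟩

instance prod {X Y : Type*} [SortProd V W X] [SortProd V W Y] : SortProd V W (X × Y) where
  HIdx := HIdx V W X ⊕ HIdx V W Y
  QIdx := QIdx V W X ⊕ QIdx V W Y
  eqv := ⟨fun p => (Sum.elim (eqv p.1).1 (eqv p.2).1, Sum.elim (eqv p.1).2 (eqv p.2).2),
    fun q => (eqv.symm (fun i => q.1 (.inl i), fun i => q.2 (.inl i)),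
      eqv.symm (fun i => q.1 (.inr i), fun i => q.2 (.inr i))),
    fun p => by simp,
    fun q => by
      ext i <;> rcases i with i | i <;> simp⟩

instance pi {J : Type} [Finite J] {X : Type*} [SortProd V W X] : SortProd V W (J → X) where
  HIdx := J × HIdx V W X
  QIdx := J × QIdx V W X
  eqv := ⟨fun p => (fun i => (eqv (p i.1)).1 i.2, fun i => (eqv (p i.1)).2 i.2),
    fun q j => eqv.symm (fun i => q.1 (j, i), fun i => q.2 (j, i)),
    fun p => by simp,
    fun q => by ext i <;> simp⟩

/-- The index type of the home-sort variables that cover `X`. -/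
abbrev Idx (V : Type u) (W : Type v) (X : Type*) [SortProd V W X] : Type := HIdx V W X ⊕ QIdx V W X

/-- The projection of a power of `V` onto a product of sorts. -/
def cover (π : V →ₗ[F] W) {X : Type*} [SortProd V W X] (z : Idx V W X → V) : X :=
  eqv.symm (fun i => z (.inl i), fun i => π (z (.inr i)))

theorem cover_surjective (hp : DensePair π e) {X : Type*} [SortProd V W X] (x : X) :
    ∃ z, cover π z = x := by
  choose f hf using hp.surj
  refine ⟨Sum.elim (eqv x).1 (fun i => f ((eqv (V := V) x).2 i)), ?_⟩
  simp [cover, hf]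

theorem cover_eq_iff {X : Type*} [SortProd V W X] (z z' : Idx V W X → V) :
    cover π z = cover π z' ↔ (∀ i, z (.inl i) = z' (.inl i)) ∧
      ∀ i, π (z (.inr i)) = π (z' (.inr i)) := by
  simp [cover, funext_iff]

end SortProd

open SortProd

section

variable {B X Y Z : Type*} [SortProd V W B] [SortProd V W X] [SortProd V W Y] [SortProd V W Z]

/-- Predicates on a product of sorts that are definable without parameters. -/
def Dfn (π : V →ₗ[F] W) (e : V) (P : X → Prop) : Prop :=
  QFDef π e (fun z => P (cover π z))

/-- Maps between products of sorts given by terms. -/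
@[fun_prop]
def TermMap (π : V →ₗ[F] W) (e : V) (g : X → Y) : Prop :=
  ∃ G : (Idx V W X → V) → Idx V W Y → V, (∀ i, AffineFn F e (fun z => G z i)) ∧
    ∀ z, g (cover π z) = cover π (G z)

namespace TermMap

@[fun_prop]
theorem comp {g : Y → Z} {f : X → Y} (hg : TermMap π e g) (hf : TermMap π e f) :
    TermMap π e (fun x => g (f x)) := by
  obtain ⟨G, hG, h⟩ := hg
  obtain ⟨G', hG', h'⟩ := hf
  exact ⟨fun z => G (G' z), fun i => (hG i).comp hG', fun z => by simp only [h', h]⟩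

@[fun_prop]
theorem id : TermMap π e (fun x : X => x) :=
  ⟨fun z => z, fun i => .coord i, fun _ => rfl⟩

@[fun_prop]
theorem fst : TermMap π e (fun p : X × Y => p.1) :=
  ⟨fun z i => z (i.map Sum.inl Sum.inl), fun _ => .coord _, fun _ => rfl⟩

@[fun_prop]
theorem snd : TermMap π e (fun p : X × Y => p.2) :=
  ⟨fun z i => z (i.map Sum.inr Sum.inr), fun _ => .coord _, fun _ => rfl⟩

@[fun_prop]
theorem pair {f : X → Y} {g : X → Z} (hf : TermMap π e f) (hg : TermMap π e g) :
    TermMap π e (fun x => (f x, g x)) := by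
  obtain ⟨G, hG, h⟩ := hf
  obtain ⟨G', hG', h'⟩ := hg
  refine ⟨fun z => Sum.elim (Sum.elim (fun i => G z (.inl i)) (fun i => G' z (.inl i)))
    (Sum.elim (fun i => G z (.inr i)) (fun i => G' z (.inr i))), fun i => ?_,
    fun z => by simp only [h, h']; rfl⟩
  rcases i with (i | i) | (i | i)
  exacts [hG _, hG' _, hG _, hG' _]

@[fun_prop]
theorem apply {J : Type} [Finite J] (j : J) : TermMap π e (fun f : J → Y => f j) :=
  ⟨fun z i => z (i.map (Prod.mk j) (Prod.mk j)), fun _ => .coord _, fun _ => rfl⟩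

@[fun_prop]
theorem pi {J : Type} [Finite J] {f : X → J → Y} (hf : ∀ j, TermMap π e (fun x => f x j)) :
    TermMap π e f := by
  choose G hG h using hf
  refine ⟨fun z => Sum.elim (fun p : J × _ => G p.1 z (.inl p.2))
    (fun p : J × _ => G p.1 z (.inr p.2)), fun i => ?_, fun z => ?_⟩
  · rcases i with i | i
    exacts [hG _ _, hG _ _]
  · funext j
    simp only [h]
    rfl

theorem home_iff {f : X → V} :
    TermMap π e f ↔ ∃ h, AffineFn F e h ∧ ∀ z : Idx V W X → V, f (cover π z) = h z :=
  ⟨fun ⟨_, hG, h⟩ => ⟨_, hG (.inl ()), h⟩, fun ⟨h, hh, H⟩ => ⟨fun z _ => h z, fun _ => hh, H⟩⟩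

theorem quo_iff {f : X → W} :
    TermMap π e f ↔ ∃ h, AffineFn F e h ∧ ∀ z : Idx V W X → V, f (cover π z) = π (h z) :=
  ⟨fun ⟨_, hG, h⟩ => ⟨_, hG (.inr ()), h⟩, fun ⟨h, hh, H⟩ => ⟨fun z _ => h z, fun _ => hh, H⟩⟩

@[fun_prop]
theorem add {f g : X → V} (hf : TermMap π e f) (hg : TermMap π e g) :
    TermMap π e (fun x => f x + g x) := by
  obtain ⟨a, ha, ha'⟩ := home_iff.1 hf
  obtain ⟨b, hb, hb'⟩ := home_iff.1 hg
  exact home_iff.2 ⟨_, ha.add hb, fun z => by simp only [ha', hb']⟩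

@[fun_prop]
theorem smul (c : F) {f : X → V} (hf : TermMap π e f) : TermMap π e (fun x => c • f x) := by
  obtain ⟨a, ha, ha'⟩ := home_iff.1 hf
  exact home_iff.2 ⟨_, ha.smul c, fun z => by simp only [ha']⟩

@[fun_prop]
theorem neg {f : X → V} (hf : TermMap π e f) : TermMap π e (fun x => - f x) := by
  simpa using hf.smul (-1)

@[fun_prop]
theorem addQ {f g : X → W} (hf : TermMap π e f) (hg : TermMap π e g) :
    TermMap π e (fun x => f x + g x) := by
  obtain ⟨a, ha, ha'⟩ := quo_iff.1 hf
  obtain ⟨b, hb, hb'⟩ := quo_iff.1 hg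
  exact quo_iff.2 ⟨_, ha.add hb, fun z => by simp only [ha', hb', map_add]⟩

@[fun_prop]
theorem smulQ (c : F) {f : X → W} (hf : TermMap π e f) : TermMap π e (fun x => c • f x) := by
  obtain ⟨a, ha, ha'⟩ := quo_iff.1 hf
  exact quo_iff.2 ⟨_, ha.smul c, fun z => by simp only [ha', map_smul]⟩

@[fun_prop]
theorem proj {f : X → V} (hf : TermMap π e f) : TermMap π e (fun x => π (f x)) := by
  obtain ⟨a, ha, ha'⟩ := home_iff.1 hf
  exact quo_iff.2 ⟨_, ha, fun z => by simp only [ha']⟩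

@[fun_prop]
theorem zero : TermMap π e (fun _ : X => (0 : V)) := home_iff.2 ⟨_, .zero, fun _ => rfl⟩

@[fun_prop]
theorem one : TermMap π e (fun _ : X => e) := home_iff.2 ⟨_, .const, fun _ => rfl⟩

@[fun_prop]
theorem zeroQ : TermMap π e (fun _ : X => (0 : W)) := quo_iff.2 ⟨_, .zero, fun _ => by simp⟩

end TermMap

namespace Dfn

theorem congr {P R : X → Prop} (h : Dfn π e P) (hPR : ∀ x, R x ↔ P x) : Dfn π e R :=
  QFDef.congr h fun _ => hPR _

theorem comp {P : Y → Prop} {g : X → Y} (hP : Dfn π e P) (hg : TermMap π e g := by fun_prop) :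
    Dfn π e (fun x => P (g x)) := by
  obtain ⟨G, hG, h⟩ := hg
  exact (QFDef.comp hP hG).congr fun z => by simp only [h]

/-- Substitution of terms in a predicate of two arguments. -/
theorem comp₂ {P : Y → Z → Prop} {f : X → Y} {g : X → Z} (hP : Dfn π e fun p : Y × Z => P p.1 p.2)
    (hf : TermMap π e f := by fun_prop)
    (hg : TermMap π e g := by fun_prop) : Dfn π e (fun x => P (f x) (g x)) :=
  hP.comp (hf.pair hg)

theorem not {P : X → Prop} (hP : Dfn π e P) : Dfn π e (fun x => ¬ P x) := QFDef.not hP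

theorem and {P R : X → Prop} (hP : Dfn π e P) (hR : Dfn π e R) : Dfn π e (fun x => P x ∧ R x) :=
  QFDef.and hP hR

theorem or {P R : X → Prop} (hP : Dfn π e P) (hR : Dfn π e R) : Dfn π e (fun x => P x ∨ R x) :=
  QFDef.or hP hR

theorem imp {P R : X → Prop} (hP : Dfn π e P) (hR : Dfn π e R) : Dfn π e (fun x => P x → R x) :=
  (hP.not.or hR).congr fun _ => by tauto

theorem iff {P R : X → Prop} (hP : Dfn π e P) (hR : Dfn π e R) : Dfn π e (fun x => P x ↔ R x) :=
  ((hP.imp hR).and (hR.imp hP)).congr fun _ => by tauto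

theorem prop (p : Prop) : Dfn π e (fun _ : X => p) := QFDef.prop p

theorem all_finite {J : Type*} [Finite J] {P : J → X → Prop} (h : ∀ j, Dfn π e (P j)) :
    Dfn π e (fun x => ∀ j, P j x) :=
  QFDef.forall_finite h

theorem ex_finite {J : Type*} [Finite J] {P : J → X → Prop} (h : ∀ j, Dfn π e (P j)) :
    Dfn π e (fun x => ∃ j, P j x) :=
  (all_finite fun j => (h j).not).not.congr fun _ => by simp

theorem lt {f g : X → V} (hf : TermMap π e f := by fun_prop)
    (hg : TermMap π e g := by fun_prop) :
    Dfn π e (fun x => f x < g x) := by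
  obtain ⟨a, ha, ha'⟩ := TermMap.home_iff.1 hf
  obtain ⟨b, hb, hb'⟩ := TermMap.home_iff.1 hg
  exact (QFDef.lt ha hb).congr fun z => by simp only [ha', hb']

theorem le {f g : X → V} (hf : TermMap π e f := by fun_prop)
    (hg : TermMap π e g := by fun_prop) :
    Dfn π e (fun x => f x ≤ g x) :=
  (lt hg hf).not.congr fun _ => not_lt.symm

theorem eq {f g : X → Y} (hf : TermMap π e f := by fun_prop)
    (hg : TermMap π e g := by fun_prop) :
    Dfn π e (fun x => f x = g x) := by
  obtain ⟨G, hG, h⟩ := hf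
  obtain ⟨G', hG', h'⟩ := hg
  refine QFDef.congr ((QFDef.forall_finite fun i => QFDef.eq (hG (.inl i)) (hG' (.inl i))).and
    (QFDef.forall_finite fun i => QFDef.proj_eq (hG (.inr i)) (hG' (.inr i)))) fun z => ?_
  simp only [h, h', cover_eq_iff]

/-- As `cover` is onto, quantifying over a product of sorts is quantifying over finitely many
home-sort variables, which `QFDef.exists_sum` eliminates. -/
theorem ex (hp : DensePair π e) {P : X → Y → Prop} (hP : Dfn π e fun p : X × Y => P p.1 p.2) :
    Dfn π e (fun x => ∃ y, P x y) := by
  have h1 : QFDef π e (fun z : Idx V W X ⊕ Idx V W Y → V =>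
      P (cover π fun i => z (.inl i)) (cover π fun i => z (.inr i))) := by
    refine (QFDef.comp hP (G := fun z => Sum.elim
      (Sum.elim (fun i => z (.inl (.inl i))) (fun i => z (.inr (.inl i))))
      (Sum.elim (fun i => z (.inl (.inr i))) (fun i => z (.inr (.inr i))))) ?_).congr
      fun _ => Iff.rfl
    rintro ((i | i) | (i | i)) <;> exact .coord _
  refine (h1.exists_sum hp).congr fun z => ⟨?_, ?_⟩
  · rintro ⟨y, hy⟩
    obtain ⟨z', rfl⟩ := cover_surjective hp y
    exact ⟨z', hy⟩
  · rintro ⟨z', hz'⟩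
    exact ⟨_, hz'⟩

theorem all (hp : DensePair π e) {P : X → Y → Prop} (hP : Dfn π e fun p : X × Y => P p.1 p.2) :
    Dfn π e (fun x => ∀ y, P x y) :=
  (ex hp (P := fun x y => ¬ P x y) hP.not).not.congr fun _ => by simp

end Dfn

end

section

variable {B X Y Z : Type*} [SortProd V W B] [SortProd V W X] [SortProd V W Y] [SortProd V W Z]

/-! ### Definable subsets of the home sort -/

/-- The truth of `S y` only depends on the position of `y` relative to the points `d i`. -/
def Tame (π : V →ₗ[F] W) {J : Type} (d : J → V) (S : V → Prop) : Prop :=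
  ∀ y y', (∀ i, SameType π (d i) y y') → (S y ↔ S y')

/-- The terms that bound `y` are affine in `u` with slopes fixed by their syntax, so only the
intercepts depend on `b`. Without uniform slopes, `choosable_of_lines` could not quantify over the
lines definably. -/
theorem Dfn.exists_lines (hp : DensePair π e) {Γ : B → V → V → Prop}
    (h : Dfn π e fun p : B × V × V => Γ p.1 p.2.1 p.2.2) :
    ∃ (k : ℕ) (α : Fin k → F), ∀ b, ∃ d : Fin k → V, ∀ u,
      Tame π (fun i => α i • u + d i) (Γ b u) := by
  have hQ : QFDef π e (fun z : Option (Option (Idx V W B)) → V =>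
      Γ (cover π fun i => z (some (some i))) (z (some none)) (z none)) := by
    refine (QFDef.comp h (G := fun z => Sum.elim
      (Sum.elim (fun i => z (some (some (.inl i))))
        (Sum.elim (fun _ => z (some none)) (fun _ => z none)))
      (Sum.elim (fun i => z (some (some (.inr i)))) (Sum.elim Empty.elim Empty.elim))) ?_).congr
      fun _ => Iff.rfl
    rintro ((i | i | i) | (i | i | i))
    exacts [.coord _, .coord _, .coord _, .coord _, i.elim, i.elim]
  obtain ⟨T, hT, hTP⟩ := hQ.exists_terms
  choose α g hg hαg using fun i : Fin T.length => (hT _ (List.get_mem T i)).exists_slope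
  refine ⟨T.length, α, fun b => ?_⟩
  obtain ⟨z, rfl⟩ := cover_surjective hp b
  refine ⟨fun i => g i z, fun u y y' hy => hTP (optCons u z) y y' fun t ht => ?_⟩
  obtain ⟨i, rfl⟩ := List.get_of_mem ht
  rw [hαg]
  exact hy i

theorem Dfn.exists_tame (hp : DensePair π e) {S : B → V → Prop}
    (h : Dfn π e fun p : B × V => S p.1 p.2) :
    ∃ k : ℕ, ∀ b, ∃ d : Fin k → V, Tame π d (S b) := by
  obtain ⟨k, α, H⟩ := Dfn.exists_lines hp (Γ := fun b _ y => S b y)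
    (h.comp (TermMap.fst.pair (TermMap.snd.comp TermMap.snd)))
  refine ⟨k, fun b => ?_⟩
  obtain ⟨d, hd⟩ := H b
  exact ⟨d, by simpa using hd 0⟩

section Tame

variable {J : Type} [Finite J] {d : J → V} {S : V → Prop}

theorem exists_right_gap (hp : DensePair π e) (d : J → V) (a : V) :
    ∃ c, a < c ∧ ∀ i, a < d i → c ≤ d i := by
  by_cases h : ∃ i, a < d i
  · obtain ⟨i, hi, hmin⟩ := ({i | a < d i} : Set J).toFinite.exists_minimalFor d _ h
    exact ⟨d i, hi, fun j hj => (le_total (d i) (d j)).elim (fun h => h) fun h => hmin hj h⟩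
  · push Not at h
    exact ⟨a + e, lt_add_of_pos_right a hp.pos, fun i hi => absurd hi (h i).not_gt⟩

theorem exists_left_gap (hp : DensePair π e) (d : J → V) (a : V) :
    ∃ c, c < a ∧ ∀ i, d i < a → d i ≤ c := by
  obtain ⟨c, hc, h⟩ := exists_right_gap hp (fun i => - d i) (-a)
  exact ⟨-c, neg_lt.1 hc, fun i hi => le_neg.1 (h i (neg_lt_neg hi))⟩

/-- Next to `a` on the right, membership only depends on the coset. -/
theorem exists_right_sameType (hp : DensePair π e) (d : J → V) (a : V) :
    ∃ c, a < c ∧ ∀ y y', a < y → y < c → a < y' → y' < c →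
      (∀ i, π y = π (d i) ↔ π y' = π (d i)) → ∀ i, SameType π (d i) y y' := by
  obtain ⟨c, hc, h⟩ := exists_right_gap hp d a
  refine ⟨c, hc, fun y y' h1 h2 h3 h4 hπ i => ?_⟩
  rcases lt_or_ge a (d i) with hi | hi
  · have := h i hi
    exact ⟨iff_of_true (h2.trans_le this) (h4.trans_le this),
      iff_of_false (h2.trans_le this).not_gt (h4.trans_le this).not_gt, hπ i⟩
  · exact ⟨iff_of_false (hi.trans_lt h1).not_gt (hi.trans_lt h3).not_gt,
      iff_of_true (hi.trans_lt h1) (hi.trans_lt h3), hπ i⟩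

theorem exists_nhds_sameType (hp : DensePair π e) (d : J → V) {y : V} (hy : ∀ i, y ≠ d i) :
    ∃ a c, a < y ∧ y < c ∧ ∀ y', a < y' → y' < c →
      (∀ i, π y = π (d i) ↔ π y' = π (d i)) → ∀ i, SameType π (d i) y y' := by
  obtain ⟨c, hc, h⟩ := exists_right_gap hp d y
  obtain ⟨a, ha, h'⟩ := exists_left_gap hp d y
  refine ⟨a, c, ha, hc, fun y' h1 h2 hπ i => ?_⟩
  rcases (hy i).lt_or_gt with hi | hi
  · have := h2.trans_le (h i hi)
    exact ⟨iff_of_true hi this, iff_of_false hi.not_gt this.not_gt, hπ i⟩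
  · have := (h' i hi).trans_lt h1
    exact ⟨iff_of_false hi.not_gt this.not_gt, iff_of_true hi this, hπ i⟩

/-- A tame set with an element other than the given points is infinite. -/
theorem Tame.infinite (hp : DensePair π e) (hS : Tame π d S) {y : V} (hy : S y)
    (hne : ∀ i, y ≠ d i) : {y | S y}.Infinite := by
  obtain ⟨a, c, ha, hc, h⟩ := exists_nhds_sameType hp d hne
  intro hfin
  -- Near `y`, the whole coset of `y` belongs to the set, and by density this part of the coset has
  -- no greatest element.
  have hsub : {y' | π y' = π y ∧ a < y' ∧ y' < c} ⊆ {y | S y} := fun y' ⟨h0, h1, h2⟩ =>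
    (hS y y' (h y' h1 h2 fun i => by rw [h0])).1 hy
  obtain ⟨m, hm, hmax⟩ := (hfin.subset hsub).exists_maximal ⟨y, rfl, ha, hc⟩
  obtain ⟨m', h0, h1, h2⟩ := hp.exists_between hm.2.2 (π y)
  exact h1.not_ge (hmax ⟨h0, hm.2.1.trans h1, h2⟩ h1.le)

/-- A `Q`-invariant tame set with an element outside of the cosets of the given points contains
all other cosets. -/
theorem Tame.mem_of_invariant (hp : DensePair π e) {R : W → Prop} (hS : Tame π d fun y => R (π y))
    {q q' : W} (hq : R q) (hne : ∀ i, q ≠ π (d i)) (hne' : ∀ i, q' ≠ π (d i)) : R q' := by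
  obtain ⟨y, rfl⟩ := hp.surj q
  obtain ⟨a, c, ha, hc, h⟩ := exists_nhds_sameType hp d (y := y) fun i hi => hne i (by rw [← hi])
  obtain ⟨y', rfl, h1, h2⟩ := hp.exists_between (ha.trans hc) q'
  exact (hS y y' (h y' h1 h2 fun i => iff_of_false (hne i) (hne' i))).1 hq

/-- The infimum is found among `m` and the points `d i`, as the greatest of them that is a lower
bound. A larger lower bound is impossible, since elements of the set could be moved below it within
their coset without changing type. -/
theorem Tame.exists_isGLB (hp : DensePair π e) (hS : Tame π d S) (hne : ∃ y, S y) {m : V}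
    (hm : ∀ y, S y → m ≤ y) : ∃ a, IsGLB {y | S y} a := by
  let d' : Option J → V := fun o => o.elim m d
  obtain ⟨o, ho, hmax⟩ := Set.Finite.exists_maximalFor d' {o | d' o ∈ lowerBounds {y | S y}}
    (Set.toFinite _) ⟨none, hm⟩
  obtain ⟨t, ht⟩ : ∃ t, t = d' o := ⟨_, rfl⟩
  rw [Set.mem_ofPred_eq, ← ht] at ho
  refine ⟨t, ho, fun a ha => ?_⟩
  by_contra hta
  push Not at hta
  -- No `d i` lies in `(t, s]`, so every point of `(t, s)` in the coset of `s` has the type of `s`.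
  -- If no `d i` exceeds `t`, any member serves.
  obtain ⟨s, hs, hsd⟩ : ∃ s, S s ∧ ∀ i, t < d i → s < d i := by
    by_cases h : ∃ i, t < d i
    · obtain ⟨i, hi, hmin⟩ := ({i | t < d i} : Set J).toFinite.exists_minimalFor d _ h
      have hi' : d i ∉ lowerBounds {y | S y} := fun h =>
        hi.not_ge (ht ▸ hmax (j := some i) h (ht ▸ le_of_lt hi))
      simp only [mem_lowerBounds, Set.mem_ofPred_eq, not_forall, not_le] at hi'
      obtain ⟨s, hs, hsi⟩ := hi'
      exact ⟨s, hs, fun j hj => hsi.trans_le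
        ((le_total (d i) (d j)).elim (fun h => h) fun h => hmin hj h)⟩
    · push Not at h
      obtain ⟨s, hs⟩ := hne
      exact ⟨s, hs, fun i hi => absurd hi (h i).not_gt⟩
  obtain ⟨y, hy, h1, h2⟩ := hp.exists_between hta (π s)
  have hts : t < s := hta.trans_le (ha hs)
  refine (h2.trans_le (ha ((hS s y fun i => ?_).1 hs))).false
  rcases lt_or_ge t (d i) with hi | hi
  · have h3 := hsd i hi
    have h4 : y < d i := (h2.trans_le (ha hs)).trans h3
    exact ⟨iff_of_true h3 h4, iff_of_false h3.not_gt h4.not_gt, by rw [hy]⟩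
  · exact ⟨iff_of_false (hi.trans_lt hts).not_gt (hi.trans_lt h1).not_gt,
      iff_of_true (hi.trans_lt hts) (hi.trans_lt h1), by rw [hy]⟩

end Tame

end

section

variable {B X Y Z : Type*} [SortProd V W B] [SortProd V W X] [SortProd V W Y] [SortProd V W Z]

/-! ### Canonical finite choice of definable subsets -/

/-- The formulas `χ` and `ψ` choose, for each nonempty set `S b`, finitely many nonempty subsets
`ψ c` of `S b`, in a way that is invariant under the relation `r` on the parameters. -/
structure IsChoice {C : Type*} [SortProd V W C] (π : V →ₗ[F] W) (e : V) (r : B → B → Prop)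
    (S : B → X → Prop) (ψ : C → X → Prop) (χ : B → C → Prop) : Prop where
  dfn_ψ : Dfn π e (fun p : C × X => ψ p.1 p.2)
  dfn_χ : Dfn π e (fun p : B × C => χ p.1 p.2)
  finite : ∀ b, (∃ x, S b x) → {c | χ b c}.Finite
  nonempty : ∀ b, (∃ x, S b x) → ∃ c, χ b c
  exists_mem : ∀ b c, (∃ x, S b x) → χ b c → ∃ x, ψ c x
  subset : ∀ b c, (∃ x, S b x) → χ b c → ∀ x, ψ c x → S b x
  ext : ∀ b b', r b b' → χ b = χ b'

/-- The family `S` has an `r`-invariant finite choice of nonempty definable subsets. -/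
def Choosable (π : V →ₗ[F] W) (e : V) (r : B → B → Prop) (S : B → X → Prop) : Prop :=
  ∃ (κ μ : Type) (_ : Finite κ) (_ : Finite μ) (ψ : (κ → V) × (μ → W) → X → Prop)
    (χ : B → (κ → V) × (μ → W) → Prop), IsChoice π e r S ψ χ

theorem SortProd.termMap_eqv_symm :
    TermMap π e (eqv.symm : (HIdx V W X → V) × (QIdx V W X → W) → X) :=
  ⟨fun z => Sum.elim (fun i => z (.inl (.inl (i, ())))) (fun i => z (.inr (.inr (i, ())))),
    fun i => by rcases i with i | i <;> exact .coord _, fun _ => rfl⟩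

theorem IsChoice.choosable {C : Type*} [SortProd V W C] {r : B → B → Prop}
    {S : B → X → Prop} {ψ : C → X → Prop} {χ : B → C → Prop} (h : IsChoice π e r S ψ χ) : Choosable π e r S := by
  refine ⟨HIdx V W C, QIdx V W C, inferInstance, inferInstance, fun c => ψ (eqv.symm c),
    fun b c => χ b (eqv.symm c), ?_, ?_, ?_, ?_, ?_, ?_, ?_⟩
  · exact h.dfn_ψ.comp₂ (termMap_eqv_symm.comp TermMap.fst)
  · exact h.dfn_χ.comp₂ TermMap.fst (termMap_eqv_symm.comp TermMap.snd)
  · exact fun b hb => (h.finite b hb).preimage eqv.symm.injective.injOn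
  · exact fun b hb => (h.nonempty b hb).imp' eqv fun c hc => by simpa using hc
  · exact fun b c hb hc => h.exists_mem b _ hb hc
  · exact fun b c hb hc => h.subset b _ hb hc
  · intro b b' hbb'
    simp only [h.ext b b' hbb']

namespace Choosable

variable {r : B → B → Prop}

theorem unit (r : B → B → Prop) (S : B → Unit → Prop) : Choosable π e r S :=
  IsChoice.choosable (C := Unit) (ψ := fun _ _ => True) (χ := fun _ _ => True)
    ⟨.prop _, .prop _, fun _ _ => Set.toFinite _, fun _ _ => ⟨(), trivial⟩,
      fun _ _ _ _ => ⟨(), trivial⟩, fun _ _ ⟨_, h⟩ _ _ _ => h, fun _ _ _ => rfl⟩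

/-- Choice after the selection of finitely many parameters. -/
theorem select (hp : DensePair π e) {S : B → X → Prop} {Δ : B → Y → Prop} {S' : B × Y → Z → Prop}
    {r' : B × Y → B × Y → Prop}
    {R : Y × Z → X → Prop} (hΔ : Dfn π e fun p : B × Y => Δ p.1 p.2)
    (hS' : Dfn π e fun p : (B × Y) × Z => S' p.1 p.2)
    (hR : Dfn π e fun p : (Y × Z) × X => R p.1 p.2)
    (fin : ∀ b, (∃ x, S b x) → {y | Δ b y}.Finite)
    (ne : ∀ b, (∃ x, S b x) → ∃ y z, Δ b y ∧ S' (b, y) z)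
    (ext : ∀ b b', r b b' → Δ b = Δ b' ∧ ∀ y, r' (b, y) (b', y) ∧ S' (b, y) = S' (b', y))
    (ex : ∀ b y z, Δ b y → S' (b, y) z → ∃ x, R (y, z) x)
    (sub : ∀ b y z x, Δ b y → S' (b, y) z → R (y, z) x → S b x)
    (h : Choosable π e r' S') : Choosable π e r S := by
  obtain ⟨κ, μ, _, _, ψ, χ, h⟩ := h
  refine IsChoice.choosable (C := Y × (κ → V) × (μ → W))
    (ψ := fun c x => ∃ z, ψ c.2 z ∧ R (c.1, z) x)
    -- Where the intermediate set is empty, `χ` is uncontrolled and may hold of infinitely many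
    -- tuples, so such `y` are discarded.
    (χ := fun b c => Δ b c.1 ∧ (∃ z, S' (b, c.1) z) ∧ χ (b, c.1) c.2) ⟨?_, ?_, ?_, ?_, ?_, ?_, ?_⟩
  · exact .ex hp (.and h.dfn_ψ.comp₂ hR.comp₂)
  · exact .and hΔ.comp₂ (.and (.ex hp hS'.comp₂) h.dfn_χ.comp₂)
  · intro b hb
    refine ((fin b hb).biUnion' (t := fun y _ => {c | c.1 = y ∧ (∃ z, S' (b, y) z) ∧ χ (b, y) c.2})
      fun y _ => ?_).subset ?_
    · by_cases hz : ∃ z, S' (b, y) z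
      · exact ((h.finite _ hz).image (Prod.mk y)).subset fun c hc => ⟨c.2, hc.2.2, by simp [← hc.1]⟩
      · simp [hz]
    · rintro ⟨y, c⟩ hc
      exact Set.mem_biUnion (show y ∈ {y | Δ b y} from hc.1) ⟨rfl, hc.2⟩
  · intro b hb
    obtain ⟨y, z, hy, hz⟩ := ne b hb
    obtain ⟨c, hc⟩ := h.nonempty _ ⟨z, hz⟩
    exact ⟨(y, c), hy, ⟨z, hz⟩, hc⟩
  · rintro b ⟨y, c⟩ hb ⟨hy, hz, hc⟩
    obtain ⟨z, hcz⟩ := h.exists_mem _ c hz hc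
    obtain ⟨x, hx⟩ := ex b y z hy (h.subset _ _ hz hc _ hcz)
    exact ⟨x, z, hcz, hx⟩
  · rintro b ⟨y, c⟩ hb ⟨hy, hz, hc⟩ x ⟨z, hcz, hx⟩
    exact sub b y z x hy (h.subset _ _ hz hc _ hcz) hx
  · intro b b' hbb'
    obtain ⟨h1, h2⟩ := ext b b' hbb'
    funext c
    simp only [h1, (h2 c.1).2, h.ext _ _ (h2 c.1).1]

/-- Choice of finitely many points. -/
theorem of_finite_select (hp : DensePair π e) {S : B → X → Prop} {Δ : B → Y → Prop}
    {R : Y → X → Prop} (hΔ : Dfn π e fun p : B × Y => Δ p.1 p.2)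
    (hR : Dfn π e fun p : Y × X => R p.1 p.2)
    (fin : ∀ b, (∃ x, S b x) → {y | Δ b y}.Finite)
    (ne : ∀ b, (∃ x, S b x) → ∃ y, Δ b y)
    (ext : ∀ b b', r b b' → Δ b = Δ b')
    (ex : ∀ b y, Δ b y → ∃ x, R y x)
    (sub : ∀ b y x, Δ b y → R y x → S b x) : Choosable π e r S :=
  select hp (Z := Unit) (r' := fun _ _ => True) (S' := fun _ _ => True)
    (R := fun p => R p.1) hΔ (.prop _) hR.comp₂ fin
    (fun b hb => (ne b hb).imp fun _ hy => ⟨(), hy, trivial⟩)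
    (fun b b' h => ⟨ext b b' h, fun _ => ⟨trivial, rfl⟩⟩)
    (fun b y _ hy _ => ex b y hy) (fun b y _ x hy _ => sub b y x hy) (unit _ _)

/-- Choice in the image of a family under a definable relation. -/
theorem image (hp : DensePair π e) {S : B → X → Prop} {r' : B → B → Prop} {S' : B → Z → Prop}
    {R : Z → X → Prop}
    (hS' : Dfn π e fun p : B × Z => S' p.1 p.2) (hR : Dfn π e fun p : Z × X => R p.1 p.2)
    (ne : ∀ b, (∃ x, S b x) → ∃ z, S' b z) (ext : ∀ b b', r b b' → r' b b' ∧ S' b = S' b')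
    (ex : ∀ b z, S' b z → ∃ x, R z x) (sub : ∀ b z x, S' b z → R z x → S b x)
    (h : Choosable π e r' S') : Choosable π e r S := by
  refine select hp (Y := Unit) (r' := fun b b' => r' b.1 b'.1) (Δ := fun _ _ => True)
    (S' := fun b => S' b.1) (R := fun p => R p.2)
    (.prop _) hS'.comp₂ hR.comp₂ (fun _ _ => Set.toFinite _)
    (fun b hb => (ne b hb).elim fun z hz => ⟨(), z, trivial, hz⟩)
    (fun b b' hb => ⟨rfl, fun _ => ext b b' hb⟩) (fun b _ z _ hz => ex b z hz)
    (fun b _ z x _ hz => sub b z x hz) ?_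
  obtain ⟨κ, μ, _, _, ψ, χ, h⟩ := h
  exact ⟨κ, μ, ‹_›, ‹_›, ψ, fun b => χ b.1, h.dfn_ψ, h.dfn_χ.comp₂,
    fun b => h.finite b.1, fun b => h.nonempty b.1, fun b => h.exists_mem b.1,
    fun b => h.subset b.1, fun b b' => h.ext b.1 b'.1⟩

/-- The first subfamily takes precedence. A last parameter, `0` or `e`, records which of the two was
used, and the parameters of the other are set to zero so that only finitely many tuples remain. -/
theorem of_two (hp : DensePair π e) {S S₁ S₂ : B → X → Prop}
    (hS₁ : Dfn π e fun p : B × X => S₁ p.1 p.2)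
    (ne : ∀ b, (∃ x, S b x) → (∃ x, S₁ b x) ∨ ∃ x, S₂ b x)
    (sub₁ : ∀ b x, S₁ b x → S b x) (sub₂ : ∀ b x, S₂ b x → S b x)
    (ext₁ : ∀ b b', r b b' → S₁ b = S₁ b')
    (h₁ : Choosable π e r S₁) (h₂ : Choosable π e r S₂) : Choosable π e r S := by
  obtain ⟨κ₁, μ₁, _, _, ψ₁, χ₁, h₁⟩ := h₁
  obtain ⟨κ₂, μ₂, _, _, ψ₂, χ₂, h₂⟩ := h₂
  have he : e ≠ 0 := hp.pos.ne'
  refine IsChoice.choosable (C := ((κ₁ → V) × (μ₁ → W)) × ((κ₂ → V) × (μ₂ → W)) × V)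
    (ψ := fun c x => c.2.2 = 0 ∧ ψ₁ c.1 x ∨ c.2.2 = e ∧ ψ₂ c.2.1 x)
    (χ := fun b c => ((∃ x, S₁ b x) ∧ χ₁ b c.1 ∧ c.2.1 = (fun _ => 0, fun _ => 0) ∧ c.2.2 = 0) ∨
      (¬ (∃ x, S₁ b x) ∧ c.1 = (fun _ => 0, fun _ => 0) ∧ χ₂ b c.2.1 ∧ c.2.2 = e))
    ⟨?_, ?_, ?_, ?_, ?_, ?_, ?_⟩
  · exact .or (.and .eq h₁.dfn_ψ.comp₂) (.and .eq h₂.dfn_ψ.comp₂)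
  · exact .or (.and (.ex hp hS₁.comp₂) (.and h₁.dfn_χ.comp₂ (.and .eq .eq)))
      (.and (.not (.ex hp hS₁.comp₂)) (.and .eq (.and h₂.dfn_χ.comp₂ .eq)))
  · intro b hb
    by_cases hb₁ : ∃ x, S₁ b x
    · refine ((h₁.finite b hb₁).image fun c => (c, (fun _ => 0, fun _ => 0), 0)).subset ?_
      rintro ⟨c₁, c₂, v⟩ (⟨_, h, h', h''⟩ | ⟨h, _⟩)
      · exact ⟨c₁, h, Prod.ext rfl (Prod.ext h'.symm h''.symm)⟩
      · exact absurd hb₁ h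
    · have hb₂ := (ne b hb).resolve_left hb₁
      refine ((h₂.finite b hb₂).image fun c => ((fun _ => 0, fun _ => 0), c, e)).subset ?_
      rintro ⟨c₁, c₂, v⟩ (⟨h, _⟩ | ⟨_, h, h', h''⟩)
      · exact absurd h hb₁
      · exact ⟨c₂, h', Prod.ext h.symm (Prod.ext rfl h''.symm)⟩
  · intro b hb
    by_cases hb₁ : ∃ x, S₁ b x
    · obtain ⟨c, hc⟩ := h₁.nonempty b hb₁
      exact ⟨(c, (fun _ => 0, fun _ => 0), 0), .inl ⟨hb₁, hc, rfl, rfl⟩⟩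
    · obtain ⟨c, hc⟩ := h₂.nonempty b ((ne b hb).resolve_left hb₁)
      exact ⟨((fun _ => 0, fun _ => 0), c, e), .inr ⟨hb₁, rfl, hc, rfl⟩⟩
  · rintro b ⟨c₁, c₂, v⟩ hb (⟨hb₁, h, -, hv⟩ | ⟨hb₁, -, h, hv⟩)
    · exact (h₁.exists_mem b _ hb₁ h).imp fun x hx => .inl ⟨hv, hx⟩
    · exact (h₂.exists_mem b _ ((ne b hb).resolve_left hb₁) h).imp fun x hx => .inr ⟨hv, hx⟩
  · rintro b ⟨c₁, c₂, v⟩ hb (⟨hb₁, h, -, hv⟩ | ⟨hb₁, -, h, hv⟩) x (⟨hv', hx⟩ | ⟨hv', hx⟩)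
    · exact sub₁ b x (h₁.subset b _ hb₁ h x hx)
    · exact absurd (hv'.symm.trans hv) he
    · exact absurd (hv.symm.trans hv') he
    · exact sub₂ b x (h₂.subset b _ ((ne b hb).resolve_left hb₁) h x hx)
  · intro b b' hb
    funext c
    simp only [ext₁ b b' hb, h₁.ext b b' hb, h₂.ext b b' hb]

theorem of_list (hp : DensePair π e) (l : List (B → X → Prop)) {S : B → X → Prop}
    (hl : ∀ S' ∈ l, (Dfn π e fun p : B × X => S' p.1 p.2) ∧ Choosable π e r S' ∧
      (∀ b x, S' b x → S b x) ∧ ∀ b b', r b b' → S' b = S' b')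
    (ne : ∀ b, (∃ x, S b x) → ∃ S' ∈ l, ∃ x, S' b x) : Choosable π e r S := by
  induction l generalizing S with
  | nil =>
    refine of_finite_select hp (Y := Unit) (Δ := fun _ _ => False) (R := fun _ _ => False)
      (.prop _) (.prop _) (fun _ _ => Set.toFinite _) (fun b hb => ?_) (fun _ _ _ => rfl)
      (fun _ _ => False.elim) (fun _ _ _ => False.elim)
    obtain ⟨_, h, _⟩ := ne b hb
    simp at h
  | cons S₁ l ih =>
    obtain ⟨h1, h2, h3, h4⟩ := hl S₁ (by simp)
    have hl' := fun S' (hS' : S' ∈ l) => hl S' (by simp [hS'])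
    refine of_two hp (S₂ := fun b x => ∃ S' ∈ l, S' b x) h1 (fun b hb => ?_) h3
      (fun b x ⟨S', hS', hx⟩ => (hl' S' hS').2.2.1 b x hx) h4 h2
      (ih (fun S' hS' => ⟨(hl' S' hS').1, (hl' S' hS').2.1, fun b x hx => ⟨S', hS', hx⟩,
        (hl' S' hS').2.2.2⟩) fun b ⟨x, S', hS', hx⟩ => ⟨S', hS', x, hx⟩)
    obtain ⟨S', hS', x, hx⟩ := ne b hb
    rcases List.mem_cons.1 hS' with rfl | hS'
    · exact .inl ⟨x, hx⟩
    · exact .inr ⟨x, S', hS', hx⟩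

theorem mono {r' : B → B → Prop} {S : B → X → Prop} (hr : ∀ b b', r b b' → r' b b')
    (h : Choosable π e r' S) : Choosable π e r S := by
  obtain ⟨κ, μ, _, _, ψ, χ, h⟩ := h
  exact ⟨κ, μ, ‹_›, ‹_›, ψ, χ, { h with ext := fun b b' hb => h.ext b b' (hr b b' hb) }⟩

end Choosable

end

section

variable {B X Y Z : Type*} [SortProd V W B] [SortProd V W X] [SortProd V W Y] [SortProd V W Z]

/-! ### Choice for subsets of the home sort -/

theorem Dfn.isGLB (hp : DensePair π e) {S : B → V → Prop}
    (hS : Dfn π e fun p : B × V => S p.1 p.2) :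
    Dfn π e (fun p : B × V => IsGLB {x | S p.1 x} p.2) := by
  have h : Dfn π e (fun p : B × V => ∀ x, S p.1 x → p.2 ≤ x) := .all hp (.imp hS.comp₂ .le)
  exact (h.and (.all hp (.imp (h.comp₂ (P := fun b a => ∀ x, S b x → a ≤ x)) .le))).congr
    fun p => Iff.rfl

/-- The coset `q` is contained in `S` near `a` on the right. -/
def RightGerm (π : V →ₗ[F] W) (S : V → Prop) (a : V) (q : W) : Prop :=
  ∃ c, a < c ∧ ∀ x, a < x → x < c → π x = q → S x

theorem Dfn.rightGerm (hp : DensePair π e) {S : B → V → Prop}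
    (hS : Dfn π e fun p : B × V => S p.1 p.2) :
    Dfn π e (fun p : B × V × W => RightGerm π (S p.1) p.2.1 p.2.2) :=
  .ex hp (.and .lt (.all hp (.imp .lt (.imp .lt (.imp .eq hS.comp₂)))))

/-- Immediately to the right of `a`, membership depends only on the coset, and cosets other than
those of the `d i` cannot be told apart. Some coset is present because the infimum is not attained.
-/
theorem Tame.exists_rightGerm (hp : DensePair π e) {J : Type} [Finite J] {d : J → V}
    {S : V → Prop} (hS : Tame π d S) {a : V} (ha : IsGLB {x | S x} a)
    (haS : ¬ S a) :
    (∃ c, a < c ∧ ∀ x, a < x → x < c → RightGerm π S a (π x) → S x) ∧ (∃ q, RightGerm π S a q) ∧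
      ((∀ q, RightGerm π S a q → ∃ i, q = π (d i)) ∨
        ∀ q, ¬ RightGerm π S a q → ∃ i, q = π (d i)) := by
  obtain ⟨c, hc, h⟩ := exists_right_sameType hp d a
  have hgerm : ∀ x, a < x → x < c → S x → RightGerm π S a (π x) := fun x h1 h2 hx =>
    ⟨c, hc, fun y h3 h4 hy => (hS x y (h x y h1 h2 h3 h4 fun i => by rw [hy])).1 hx⟩
  have hmem : ∀ x, a < x → x < c → RightGerm π S a (π x) → S x := by
    rintro x h1 h2 ⟨c', hc', h'⟩
    obtain ⟨y, hy, h3, h4⟩ := hp.exists_between (lt_min hc hc') (π x)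
    exact (hS y x (h y x h3 (h4.trans_le (min_le_left _ _)) h1 h2 fun i => by rw [hy])).1
      (h' y h3 (h4.trans_le (min_le_right _ _)) hy)
  refine ⟨⟨c, hc, hmem⟩, ?_, ?_⟩
  · obtain ⟨x, hx, hxc⟩ : ∃ x, S x ∧ x < c := by
      by_contra hcon
      push Not at hcon
      exact hc.not_ge (ha.2 fun x hx => hcon x hx)
    have hax : a < x := lt_of_le_of_ne (ha.1 hx) fun h => haS (h ▸ hx)
    exact ⟨_, hgerm x hax hxc hx⟩
  · by_contra hcon
    push Not at hcon
    obtain ⟨⟨q, hq, hqd⟩, q', hq', hqd'⟩ := hcon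
    obtain ⟨y, rfl, h1, h2⟩ := hp.exists_between hc q
    obtain ⟨y', rfl, h1', h2'⟩ := hp.exists_between hc q'
    exact hq' (hgerm y' h1' h2' ((hS y y' (h y y' h1 h2 h1' h2' fun i =>
      iff_of_false (hqd i) (hqd' i))).1 (hmem y h1 h2 hq)))

/-- Choice of an interval on the right of `a`, intersected with finitely or cofinitely many
cosets. -/
theorem Choosable.of_right (hp : DensePair π e) {r : B → B → Prop} {S : B → V → Prop}
    (hS : Dfn π e fun p : B × V => S p.1 p.2) {ρ : Y → W → Prop}
    (hρ : Dfn π e fun p : Y × W => ρ p.1 p.2) {Δ : B → V × Y → Prop}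
    (hΔ : Dfn π e fun p : B × V × Y => Δ p.1 p.2) (fin : ∀ b, {y | Δ b y}.Finite)
    (ext : ∀ b b', r b b' → S b = S b' ∧ Δ b = Δ b')
    (germ : ∀ b a y, Δ b (a, y) → ∃ c, a < c ∧ ∀ x, a < x → x < c → ρ y (π x) → S b x)
    (ex : ∀ b a y, Δ b (a, y) → ∃ q, ρ y q) :
    Choosable π e r (fun b x => S b x ∧ ∃ y, Δ b y) := by
  -- The infimum of the bad `c` is the end of the longest interval to the right of `a`, cut off at
  -- `a + e`, on which the cosets allowed by `ρ` stay inside `S b`. The cut-off guarantees that some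
  -- `c` is bad, so that the infimum exists.
  let Bad : B × V × Y → V → Prop := fun p c => p.2.1 < c ∧ (p.2.1 + e ≤ c ∨
    ∃ x, p.2.1 < x ∧ x < c ∧ ρ p.2.2 (π x) ∧ ¬ S p.1 x)
  have hBad : Dfn π e fun p : (B × V × Y) × V => Bad p.1 p.2 :=
    .and .lt (.or .le (.ex hp (.and .lt (.and .lt (.and hρ.comp₂ (.not hS.comp₂))))))
  have hglb : ∀ b a y, Δ b (a, y) → ∃ c, IsGLB {c | Bad (b, a, y) c} c := by
    intro b a y hy
    obtain ⟨k, hk⟩ := hBad.exists_tame hp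
    obtain ⟨d, hd⟩ := hk (b, a, y)
    exact hd.exists_isGLB hp ⟨a + e, lt_add_of_pos_right a hp.pos, .inl le_rfl⟩ fun c hc => hc.1.le
  refine of_finite_select hp (Y := (V × Y) × V)
    (Δ := fun b y => Δ b y.1 ∧ IsGLB {c | Bad (b, y.1) c} y.2)
    (R := fun y x => y.1.1 < x ∧ x < y.2 ∧ ρ y.1.2 (π x)) ?_ ?_ ?_ ?_ ?_ ?_ ?_
  · exact .and hΔ.comp₂
      ((hBad.isGLB hp).comp₂ (P := fun b c => IsGLB {x | Bad b x} c)
        (f := fun p : B × (V × Y) × V => (p.1, p.2.1)))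
  · exact .and .lt (.and .lt hρ.comp₂)
  · intro b _
    refine Set.Finite.of_finite_image (f := Prod.fst) ((fin b).subset ?_) ?_
    · rintro _ ⟨y, hy, rfl⟩
      exact hy.1
    · rintro ⟨y, c⟩ hc ⟨y', c'⟩ hc' (rfl : y = y')
      exact Prod.ext rfl (hc.2.unique hc'.2)
  · rintro b ⟨x, hx, ⟨a, y⟩, hy⟩
    obtain ⟨c, hc⟩ := hglb b a y hy
    exact ⟨((a, y), c), hy, hc⟩
  · intro b b' hb
    obtain ⟨h1, h2⟩ := ext b b' hb
    simp only [h2, Bad, h1]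
  · rintro b ⟨⟨a, y⟩, c⟩ ⟨hy, hc⟩
    obtain ⟨c', hc', hgood⟩ := germ b a y hy
    obtain ⟨q, hq⟩ := ex b a y hy
    -- The germ hypothesis yields an initial interval none of whose points is bad.
    have hac : a < c := by
      refine (lt_min hc' (lt_add_of_pos_right a hp.pos)).trans_le (hc.2 ?_)
      rintro c₁ ⟨-, h | ⟨x, h1, h2, h3, h4⟩⟩
      · exact (min_le_right _ _).trans h
      · refine (min_le_left _ _).trans (le_of_not_gt fun h => h4 (hgood x h1 (h2.trans h) h3))
    obtain ⟨x, rfl, h1, h2⟩ := hp.exists_between hac q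
    exact ⟨x, h1, h2, hq⟩
  · rintro b ⟨⟨a, y⟩, c⟩ x ⟨hy, hc⟩ ⟨h1, h2, h3⟩
    refine ⟨?_, _, hy⟩
    by_contra hx
    obtain ⟨c', -, h4, h5⟩ := hp.exists_between h2 0
    exact h5.not_ge (hc.1 ⟨h1.trans h4, .inr ⟨x, h1, h4, h3, hx⟩⟩)

/-- Finite sets of cosets are handled as tuples of one fixed length. The entries `f i` outside of
`P` are replaced by the known element `c`, which also fills the last place. -/
theorem exists_enumeration {k : ℕ} {P : W → Prop} {f : Fin k → W} {c : W} (hc : P c)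
    (h : ∀ q, P q → (∃ i, q = f i) ∨ q = c) :
    ∃ g : Fin (k + 1) → W, ∀ q, P q ↔ ∃ i, g i = q := by
  classical
  refine ⟨Fin.snoc (α := fun _ => W) (fun i => if P (f i) then f i else c) c,
    fun q => ⟨fun hq => ?_, ?_⟩⟩
  · rcases h q hq with ⟨i, rfl⟩ | rfl
    · exact ⟨i.castSucc, by simp [hq]⟩
    · exact ⟨Fin.last k, by simp⟩
  · rintro ⟨i, rfl⟩
    refine Fin.lastCases ?_ (fun i => ?_) i
    · simpa using hc
    · simp only [Fin.snoc_castSucc]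
      split_ifs with hi
      exacts [hi, hc]

/-- A finite set has finitely many enumerations of given length. Keeping all of them avoids a
non-canonical selection. -/
theorem finite_enumerations {n : ℕ} (A : Set V) (P : V → W → Prop) :
    {y : V × (Fin n → W) | IsGLB A y.1 ∧ ∀ q, P y.1 q ↔ ∃ i, y.2 i = q}.Finite := by
  rcases Set.eq_empty_or_nonempty
    {y : V × (Fin n → W) | IsGLB A y.1 ∧ ∀ q, P y.1 q ↔ ∃ i, y.2 i = q} with h | ⟨⟨a, g⟩, ha, hg⟩
  · rw [h]
    exact Set.finite_empty
  · refine ((Set.finite_singleton a).prod (Set.Finite.pi' (ι := Fin n)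
      (t := fun _ => Set.range g) fun _ => Set.finite_range g)).subset ?_
    rintro ⟨a', g'⟩ ⟨ha', hg'⟩
    obtain rfl : a' = a := ha'.unique ha
    exact ⟨rfl, fun i => (hg _).1 ((hg' _).2 ⟨i, rfl⟩)⟩

/-- The lower bound `0` gives an infimum `a`. If `a` belongs to the set, it is the choice. Otherwise
the choice is an interval to the right of `a`, intersected with cosets in the germ of the set at
`a`; these are recorded by an enumeration of the cosets present or of the cosets missing, whichever
are few. -/
theorem choosable_of_nonneg (hp : DensePair π e) {S : B → V → Prop}
    (hS : Dfn π e fun p : B × V => S p.1 p.2) (hpos : ∀ b x, S b x → 0 ≤ x) :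
    Choosable π e (fun b b' => S b = S b') S := by
  obtain ⟨k, hk⟩ := hS.exists_tame hp
  have hglb := hS.isGLB hp
  have hger := hS.rightGerm hp
  let S₁ : B → V → Prop := fun b x => S b x ∧ IsGLB {x | S b x} x
  let Δ₂ : B → V × (Fin (k + 1) → W) → Prop := fun b y =>
    ¬ S b y.1 ∧ IsGLB {x | S b x} y.1 ∧ ∀ q, RightGerm π (S b) y.1 q ↔ ∃ i, y.2 i = q
  -- The missing cosets are enumerated together with `0`: there may be none, and only a nonempty set
  -- is the range of a tuple indexed by `Fin (k + 1)`. Infinitely many cosets still remain allowed.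
  let Δ₃ : B → V × (Fin (k + 1) → W) → Prop := fun b y =>
    ¬ S b y.1 ∧ IsGLB {x | S b x} y.1 ∧ ∀ q, (¬ RightGerm π (S b) y.1 q ∨ q = 0) ↔ ∃ i, y.2 i = q
  have hS₁ : Dfn π e fun p : B × V => S₁ p.1 p.2 := .and hS hglb
  have hΔ₂ : Dfn π e fun p : B × V × (Fin (k + 1) → W) => Δ₂ p.1 p.2 :=
    .and (.not hS.comp₂) (.and (hglb.comp₂ (P := fun b a => IsGLB {x | S b x} a)) (.all hp (.iff
      (hger.comp (g := fun p : (B × V × (Fin (k + 1) → W)) × W => (p.1.1, p.1.2.1, p.2)))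
      (.ex_finite fun i => .eq))))
  have hΔ₃ : Dfn π e fun p : B × V × (Fin (k + 1) → W) => Δ₃ p.1 p.2 :=
    .and (.not hS.comp₂) (.and (hglb.comp₂ (P := fun b a => IsGLB {x | S b x} a)) (.all hp (.iff
      (.or (.not
        (hger.comp (g := fun p : (B × V × (Fin (k + 1) → W)) × W => (p.1.1, p.1.2.1, p.2)))) .eq)
      (.ex_finite fun i => .eq))))
  have hρ : Dfn π e fun p : (Fin (k + 1) → W) × W => ∃ i, p.1 i = p.2 := .ex_finite fun i => .eq
  have key : ∀ b a, IsGLB {x | S b x} a → ¬ S b a →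
      ∃ c, a < c ∧ ∀ x, a < x → x < c → RightGerm π (S b) a (π x) → S b x := fun b a h h' =>
    have ⟨_, hd⟩ := hk b
    (hd.exists_rightGerm hp h h').1
  refine Choosable.of_list hp [S₁, fun b x => S b x ∧ ∃ y, Δ₂ b y, fun b x => S b x ∧ ∃ y, Δ₃ b y]
    ?_ ?_
  · simp only [List.mem_cons, List.not_mem_nil, or_false, forall_eq_or_imp, forall_eq]
    refine ⟨⟨hS₁, ?_, fun _ _ h => h.1, fun b b' h => by simp only [S₁, h]⟩,
      ⟨.and hS (.ex hp hΔ₂.comp₂), ?_, fun _ _ h => h.1, fun b b' h => by simp only [Δ₂, h]⟩,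
      ⟨.and hS (.ex hp hΔ₃.comp₂), ?_, fun _ _ h => h.1, fun b b' h => by simp only [Δ₃, h]⟩⟩
    · refine Choosable.of_finite_select hp (Δ := S₁) (R := fun y x => x = y) hS₁ .eq ?_
        (fun _ h => h) (fun b b' h => by simp only [S₁, h]) (fun _ y _ => ⟨y, rfl⟩) ?_
      · exact fun b _ => Set.Subsingleton.finite fun x hx y hy => hx.2.unique hy.2
      · rintro b y x hy rfl
        exact hy
    · refine Choosable.of_right hp hS (ρ := fun g q => ∃ i, g i = q) hρ hΔ₂
        (fun b => (finite_enumerations _ _).subset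
        fun y hy => hy.2) (fun b b' h => ⟨h, by simp only [Δ₂, h]⟩) ?_ ?_
      · rintro b a g ⟨h1, h2, h3⟩
        obtain ⟨c, hc, h⟩ := key b a h2 h1
        exact ⟨c, hc, fun x hx hx' hq => h x hx hx' ((h3 _).2 hq)⟩
      · exact fun b a g _ => ⟨g 0, 0, rfl⟩
    · refine Choosable.of_right hp hS (ρ := fun g q => ¬ ∃ i, g i = q) hρ.not hΔ₃
        (fun b => (finite_enumerations _
        (fun a q => ¬ RightGerm π (S b) a q ∨ q = 0)).subset
        fun y hy => hy.2) (fun b b' h => ⟨h, by simp only [Δ₃, h]⟩) ?_ ?_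
      · rintro b a g ⟨h1, h2, h3⟩
        obtain ⟨c, hc, h⟩ := key b a h2 h1
        refine ⟨c, hc, fun x hx hx' hq => h x hx hx' ?_⟩
        by_contra hcon
        exact hq ((h3 _).1 (.inl hcon))
      · intro b a g _
        have := hp.infinite
        obtain ⟨q, hq⟩ := (Set.finite_range g).exists_notMem
        exact ⟨q, fun ⟨i, hi⟩ => hq ⟨i, hi⟩⟩
  · rintro b ⟨x, hx⟩
    obtain ⟨d, hd⟩ := hk b
    obtain ⟨a, ha⟩ := hd.exists_isGLB hp ⟨x, hx⟩ (hpos b)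
    by_cases haS : S b a
    · exact ⟨S₁, by simp, a, haS, ha⟩
    · obtain ⟨-, ⟨q, hq⟩, h | h⟩ := hd.exists_rightGerm hp ha haS
      · obtain ⟨g, hg⟩ := exists_enumeration (P := RightGerm π (S b) a) hq
          fun q hq => .inl (h q hq)
        exact ⟨fun b x => S b x ∧ ∃ y, Δ₂ b y, by simp, x, hx, (a, g), haS, ha, hg⟩
      · obtain ⟨g, hg⟩ := exists_enumeration (P := fun q => ¬ RightGerm π (S b) a q ∨ q = 0)
          (f := fun i => π (d i)) (c := 0) (.inr rfl) fun q hq => hq.imp_left (h q)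
        exact ⟨fun b x => S b x ∧ ∃ y, Δ₃ b y, by simp, x, hx, (a, g), haS, ha, hg⟩

/-- Splitting at `0` supplies the lower bound needed for an infimum; the nonpositive half is
reflected. -/
theorem choosable_home (hp : DensePair π e) {S : B → V → Prop}
    (hS : Dfn π e fun p : B × V => S p.1 p.2) : Choosable π e (fun b b' => S b = S b') S := by
  have h₁ : Dfn π e fun p : B × V => S p.1 p.2 ∧ 0 ≤ p.2 := .and hS .le
  have h₂ : Dfn π e fun p : B × V => S p.1 (-p.2) ∧ 0 ≤ p.2 := .and hS.comp₂ .le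
  refine Choosable.of_two hp (S₁ := fun b x => S b x ∧ 0 ≤ x) (S₂ := fun b x => S b x ∧ x ≤ 0) h₁ ?_
    (fun _ _ h => h.1) (fun _ _ h => h.1) (fun b b' h => by simp only [h])
    ((choosable_of_nonneg hp h₁ fun _ _ h => h.2).mono fun b b' h => by simp only [h])
    (Choosable.image hp (S' := fun b x => S b (-x) ∧ 0 ≤ x) (R := fun z x => x = -z) h₂ .eq ?_
      (fun b b' h => by simp only [h, and_self]) (fun _ z _ => ⟨-z, rfl⟩) ?_
      (choosable_of_nonneg hp h₂ fun _ _ h => h.2))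
  · rintro b ⟨x, hx⟩
    exact (le_total 0 x).imp (fun h => ⟨x, hx, h⟩) fun h => ⟨x, hx, h⟩
  · rintro b ⟨x, hx, h⟩
    exact ⟨-x, by simpa using hx, by simpa using h⟩
  · rintro b z x ⟨hz, h⟩ rfl
    exact ⟨hz, by simpa using h⟩

end

section

variable {B X Y Z C : Type*} [SortProd V W B] [SortProd V W X] [SortProd V W Y] [SortProd V W Z]
  [SortProd V W C]

/-! ### Choice for families with finite fibers over the home sort -/

/-- Points on a line that lie on `k` given lines, in more than `k` places. -/
theorem exists_line_eq [AddCommGroup Z] [Module F Z] {k : ℕ} {α : Fin k → F} {d : Fin k → Z}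
    {β : F} {z : Z} {s : Fin (k + 1) → Z} (hs : ∀ i j, s i = s j → i = j)
    (h : ∀ i, ∃ l, β • s i + z = α l • s i + d l) : ∃ l, z = d l := by
  choose l hl using h
  -- Two of the `k + 1` points lie on the same given line. Their abscissas differ, so the slopes
  -- agree, and then so do the intercepts.
  obtain ⟨i, j, hij, hlij⟩ := Fintype.exists_ne_map_eq_of_card_lt l (by simp)
  refine ⟨l i, ?_⟩
  have h1 := hl i
  have h2 := hl j
  rw [← hlij] at h2
  have h3 : (β - α (l i)) • (s i - s j) = 0 := by
    have : (β • s i + z) - (β • s j + z) =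
        (α (l i) • s i + d (l i)) - (α (l i) • s j + d (l i)) := by
      rw [h1, h2]
    rw [add_sub_add_right_eq_sub, add_sub_add_right_eq_sub] at this
    rw [sub_smul, smul_sub, smul_sub, this, sub_self]
  rcases smul_eq_zero.1 h3 with h4 | h4
  · rw [sub_eq_zero.1 h4] at h1
    exact add_left_cancel h1
  · exact absurd (hs i j (sub_eq_zero.1 h4)) hij

/-- Call a line with one of the slopes `α j` rich if `Γ b` has points on it at `k + 1` different
values of `p u`. By `exists_line_eq` its intercept is one of the `d i`, so there are finitely many
rich lines, and they depend only on the set `Γ b`, not on the chosen `d`. If one exists, restrict `Γ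
b` to a rich line; if not, only finitely many `z` occur and one of them is fixed, as a line of slope
`0`. In both cases `z` is recovered from `u` and the selected intercept, so a subset of `V × C`
remains, to which `ih` applies. -/
theorem choosable_of_lines (hp : DensePair π e) [AddCommGroup Z] [Module F Z] {p : V → Z}
    (hpT : TermMap π e p) (hline : ∀ β : F, TermMap π e fun q : V × Z => β • p q.1 + q.2)
    {Γ : B → V × Z × C → Prop} (hΓ : Dfn π e fun q : B × V × Z × C => Γ q.1 q.2)
    {k : ℕ} {α : Fin k → F}
    (hl : ∀ b, ∃ d : Fin k → Z, ∀ u z c, Γ b (u, z, c) → ∃ i, z = α i • p u + d i)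
    (ih : ∀ β : F, Choosable π e
      (fun q q' : B × Z => (fun x : V × C => Γ q.1 (x.1, β • p x.1 + q.2, x.2)) =
        fun x : V × C => Γ q'.1 (x.1, β • p x.1 + q'.2, x.2))
      (fun (q : B × Z) (x : V × C) => Γ q.1 (x.1, β • p x.1 + q.2, x.2))) :
    Choosable π e (fun b b' => Γ b = Γ b') Γ := by
  let Δ : F → B → Z → Prop := fun β b d => ∃ s : Fin (k + 1) → V,
    (∀ i j, p (s i) = p (s j) → i = j) ∧ ∀ i, ∃ c, Γ b (s i, β • p (s i) + d, c)
  let Δ' : B → Z → Prop := fun b d => (∃ u c, Γ b (u, d, c)) ∧ ∀ j, ¬ ∃ d', Δ (α j) b d'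
  have hΓβ : ∀ β : F, Dfn π e fun q : (B × Z) × V × C =>
      Γ q.1.1 (q.2.1, β • p q.2.1 + q.1.2, q.2.2) := fun β =>
    hΓ.comp₂ (by fun_prop) (TermMap.pair (by fun_prop)
      (((hline β).comp (f := fun q : (B × Z) × V × C => (q.2.1, q.1.2)) (by fun_prop)).pair
        (by fun_prop)))
  have hΔ : ∀ β, Dfn π e fun q : B × Z => Δ β q.1 q.2 := fun β =>
    .ex hp (.and (.all_finite fun i => .all_finite fun j => .imp .eq (.prop _))
      (.all_finite fun i => .ex hp ((hΓβ β).comp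
        (g := fun q : ((B × Z) × (Fin (k + 1) → V)) × C => (q.1.1, q.1.2 i, q.2)))))
  have hno : Dfn π e fun b : B => ∀ j, ¬ ∃ d', Δ (α j) b d' :=
    .all_finite fun j => .not (.ex hp (hΔ _))
  have hΔ' : Dfn π e fun q : B × Z => Δ' q.1 q.2 :=
    .and (.ex hp (.ex hp hΓ.comp₂)) hno.comp
  have extΔ : ∀ β b b', Γ b = Γ b' → Δ β b = Δ β b' := fun β b b' h => by simp only [Δ, h]
  have hR : ∀ β : F, Dfn π e fun q : (Z × V × C) × V × Z × C =>
      q.2 = (q.1.2.1, β • p q.1.2.1 + q.1.1, q.1.2.2) := fun β =>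
    .eq (by fun_prop) (TermMap.pair (by fun_prop)
      (((hline β).comp (f := fun q : (Z × V × C) × V × Z × C => (q.1.2.1, q.1.1))
        (by fun_prop)).pair (by fun_prop)))
  refine Choosable.of_list hp ((fun b x => Γ b x ∧ ∀ j, ¬ ∃ d', Δ (α j) b d') ::
    List.ofFn fun (j : Fin k) b x => Γ b x ∧ ∃ d, Δ (α j) b d ∧ x.2.1 = α j • p x.1 + d) ?_ ?_
  · simp only [List.mem_cons, List.mem_ofFn, forall_eq_or_imp, forall_exists_index,
      forall_apply_eq_imp_iff]
    refine ⟨⟨.and hΓ hno.comp, ?_, fun _ _ h => h.1, fun b b' h => by simp only [Δ, h]⟩,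
      fun j => ⟨.and hΓ (.ex hp (.and (hΔ _).comp₂ (.eq (by fun_prop) ((hline (α j)).comp
        (f := fun q : (B × V × Z × C) × Z => (q.1.2.1, q.2)) (by fun_prop))))), ?_,
        fun _ _ h => h.1, fun b b' h => by simp only [Δ, h]⟩⟩
    · refine Choosable.select hp (Δ := Δ')
        (R := fun y x => x = (y.2.1, (0 : F) • p y.2.1 + y.1, y.2.2))
        hΔ' (hΓβ 0) (hR 0) ?_ ?_ ?_ (fun _ _ _ _ _ => ⟨_, rfl⟩) ?_ (ih 0)
      · rintro b ⟨x, hx, hno⟩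
        obtain ⟨d, hd⟩ := hl b
        -- If `Γ b` had points on the `i`-th covering line at infinitely many abscissas, that line
        -- would be rich.
        have hfin : ∀ i, {q : Z | ∃ u c, p u = q ∧ Γ b (u, α i • q + d i, c)}.Finite := by
          intro i
          by_contra hinf
          refine hno i ⟨d i, ?_⟩
          let f := Set.Infinite.natEmbedding _ hinf
          choose u c hu hc using fun n : Fin (k + 1) => (f n).2
          refine ⟨u, fun i j hij => ?_, fun i => ⟨c i, by rw [hu]; exact hc i⟩⟩
          rw [hu, hu] at hij
          exact Fin.ext (f.injective (Subtype.ext hij))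
        refine (Set.finite_iUnion fun i => (hfin i).image fun q => α i • q + d i).subset ?_
        rintro z ⟨⟨u, c, hz⟩, -⟩
        obtain ⟨i, rfl⟩ := hd u z c hz
        exact Set.mem_iUnion.2 ⟨i, p u, ⟨u, c, rfl, hz⟩, rfl⟩
      · rintro b ⟨⟨u, z, c⟩, hx, hno⟩
        exact ⟨z, (u, c), ⟨⟨u, c, hx⟩, hno⟩, by simpa using hx⟩
      · intro b b' h
        simp only [Δ', Δ, h, and_self, implies_true]
      · rintro b d ⟨u, c⟩ _ hd hx rfl
        exact ⟨hx, hd.2⟩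
    · refine Choosable.select hp (Δ := Δ (α j))
        (R := fun y x => x = (y.2.1, α j • p y.2.1 + y.1, y.2.2)) (hΔ _) (hΓβ (α j)) (hR (α j))
        ?_ ?_ ?_ (fun _ _ _ _ _ => ⟨_, rfl⟩) ?_ (ih (α j))
      · rintro b -
        obtain ⟨d, hd⟩ := hl b
        refine (Set.finite_range d).subset ?_
        rintro z ⟨s, hs, h⟩
        obtain ⟨l, hl⟩ := exists_line_eq (α := α) (d := d) (β := α j) (z := z)
          (s := fun i => p (s i)) hs fun i => (h i).elim fun c hc => hd _ _ c hc
        exact ⟨l, hl.symm⟩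
      · rintro b ⟨⟨u, z, c⟩, hx, d, hd, h⟩
        exact ⟨d, (u, c), hd, by simpa [← h] using hx⟩
      · intro b b' h
        simp only [Δ, h, and_self, implies_true]
      · rintro b d ⟨u, c⟩ _ hd hx rfl
        exact ⟨hx, d, hd, rfl⟩
  · rintro b ⟨⟨u, z, c⟩, hx⟩
    by_cases hno : ∀ j, ¬ ∃ d', Δ (α j) b d'
    · exact ⟨_, List.mem_cons_self .., _, hx, hno⟩
    · push Not at hno
      obtain ⟨j, d, s, hs, h⟩ := hno
      obtain ⟨c', hc'⟩ := h 0
      exact ⟨_, List.mem_cons_of_mem _ (List.mem_ofFn.2 ⟨j, rfl⟩), _, hc', d, ⟨s, hs, h⟩, rfl⟩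

end

section

/-- Families of subsets of `V × C` with finite fibers over `V` admit canonical choice. -/
def FiniteFiberChoice (π : V →ₗ[F] W) (e : V) (C : Type*) [SortProd V W C] : Prop :=
  ∀ (B : Type (max u v)) [SortProd V W B] (Γ : B → V × C → Prop),
    (Dfn π e fun q : B × V × C => Γ q.1 q.2) → (∀ b u, {c | Γ b (u, c)}.Finite) →
    Choosable π e (fun b b' => Γ b = Γ b') Γ

namespace FiniteFiberChoice

variable {C C' : Type*} [SortProd V W C] [SortProd V W C']

theorem unit (hp : DensePair π e) : FiniteFiberChoice π e Unit := fun B _ Γ hΓ _ =>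
  Choosable.image hp (S' := fun b u => Γ b (u, ())) (R := fun u x => x = (u, ()))
    (hΓ.comp₂ (by fun_prop) (TermMap.pair (by fun_prop) ⟨fun _ => Empty.elim ∘ Sum.elim id id,
      fun i => (Sum.elim id id i : Empty).elim, fun _ => rfl⟩))
    ((Dfn.eq (f := fun q : V × V × Unit => q.2.1) (g := fun q => q.1)).congr fun q =>
      ⟨fun h => by rw [h], fun h => Prod.ext h rfl⟩)
    (fun _ ⟨x, hx⟩ => ⟨x.1, hx⟩) (fun b b' h => by simp only [h, and_self])
    (fun _ _ _ => ⟨_, rfl⟩) (fun _ _ _ hz h => h ▸ hz) (choosable_home hp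
      (hΓ.comp₂ (by fun_prop) (TermMap.pair (by fun_prop) ⟨fun _ => Empty.elim ∘ Sum.elim id id,
      fun i => (Sum.elim id id i : Empty).elim, fun _ => rfl⟩)))

theorem of_equiv (hp : DensePair π e) (h : FiniteFiberChoice π e C) (f : C ≃ C')
    (hf : TermMap π e f) : FiniteFiberChoice π e C' := fun B _ Γ hΓ hfin =>
  have hΓ' : Dfn π e fun q : B × V × C => Γ q.1 (q.2.1, f q.2.2) := hΓ.comp₂
  Choosable.image hp (S' := fun b x => Γ b (x.1, f x.2)) (R := fun z x => x = (z.1, f z.2)) hΓ' .eq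
    (fun _ ⟨x, hx⟩ => ⟨(x.1, f.symm x.2), by simpa using hx⟩)
    (fun b b' h => by simp only [h, and_self]) (fun _ _ _ => ⟨_, rfl⟩) (fun _ _ _ hz h => h ▸ hz)
    (h B _ hΓ' fun b u => (hfin b u).preimage (f := f) f.injective.injOn)

/-- The values of the new coordinate over `u` form a finite tame set, so by `Tame.infinite` they are
among the points `α i • u + d i`. -/
theorem home (hp : DensePair π e) (h : FiniteFiberChoice π e C) :
    FiniteFiberChoice π e (V × C) := by
  intro B _ Γ hΓ hfin
  have h1 : Dfn π e fun q : B × V × V => ∃ c, Γ q.1 (q.2.1, q.2.2, c) := .ex hp hΓ.comp₂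
  obtain ⟨k, α, hk⟩ := Dfn.exists_lines hp (Γ := fun b u y => ∃ c, Γ b (u, y, c)) h1
  refine choosable_of_lines hp (p := id) (α := α) .id (fun β => by simp only [id]; fun_prop) hΓ
    (fun b => ?_) fun β => h _ _ ?_ ?_
  · obtain ⟨d, hd⟩ := hk b
    refine ⟨d, fun u z c hz => ?_⟩
    by_contra hcon
    push Not at hcon
    refine (hd u).infinite hp ⟨c, hz⟩ hcon (((hfin b u).image Prod.fst).subset ?_)
    rintro y ⟨c, hc⟩
    exact ⟨(y, c), hc, rfl⟩
  · exact hΓ.comp₂ (by fun_prop) (by simp only [id]; fun_prop)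
  · intro b u
    refine ((hfin b.1 u).image Prod.snd).subset fun c hc => ⟨(β • u + b.2, c), hc, rfl⟩

/-- The values of the new coordinate over `u` have a tame preimage in `V`. A value off the lines
would by `Tame.mem_of_invariant` bring in every other coset off the lines, which contradicts
finiteness of the fiber as `W` is infinite. -/
theorem quo (hp : DensePair π e) (h : FiniteFiberChoice π e C) :
    FiniteFiberChoice π e (W × C) := by
  intro B _ Γ hΓ hfin
  have h1 : Dfn π e fun q : B × V × V => ∃ c, Γ q.1 (q.2.1, π q.2.2, c) := .ex hp hΓ.comp₂
  obtain ⟨k, α, hk⟩ := Dfn.exists_lines hp (Γ := fun b u y => ∃ c, Γ b (u, π y, c)) h1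
  refine choosable_of_lines hp (p := π) (α := α) (by fun_prop) (fun β => by fun_prop) hΓ
    (fun b => ?_) fun β => h _ _ ?_ ?_
  · obtain ⟨d, hd⟩ := hk b
    refine ⟨fun i => π (d i), fun u z c hz => ?_⟩
    by_contra hcon
    push Not at hcon
    have := hp.infinite
    refine ((Set.finite_range fun i => α i • π u + π (d i)).union
      ((hfin b u).image Prod.fst)).not_infinite (Set.infinite_univ.mono fun q _ => ?_)
    by_cases hq : ∃ i, α i • π u + π (d i) = q
    · exact .inl hq
    · push Not at hq
      obtain ⟨c', hc'⟩ := Tame.mem_of_invariant hp (R := fun q => ∃ c, Γ b (u, q, c)) (hd u)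
        (q := z) (q' := q) ⟨c, hz⟩ (by simpa using hcon) (by simpa using fun i => (hq i).symm)
      exact .inr ⟨(q, c'), hc', rfl⟩
  · exact hΓ.comp₂
  · intro b u
    refine ((hfin b.1 u).image Prod.snd).subset fun c hc => ⟨(β • π u + b.2, c), hc, rfl⟩

theorem pow (hp : DensePair π e) {A : Type u₁} [SortProd V W A]
    (hA : ∀ (D : Type (max u₁ v₁)) [SortProd V W D], FiniteFiberChoice π e D →
      FiniteFiberChoice π e (A × D)) (κ : Type) [Finite κ] {D : Type v₁} [SortProd V W D]
    (hD : FiniteFiberChoice π e D) : FiniteFiberChoice π e ((κ → A) × D) := by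
  suffices h : ∀ _ : Finite κ, FiniteFiberChoice π e ((κ → A) × D) from h ‹_›
  refine Finite.induction_empty_option (P := fun κ => ∀ _ : Finite κ,
    FiniteFiberChoice π e ((κ → A) × D)) ?_ ?_ ?_ κ
  · intro κ κ' f h _
    have : Finite κ := .of_equiv _ f.symm
    refine (h this).of_equiv hp ((f.arrowCongr (.refl A)).prodCongr (.refl D)) ?_
    exact TermMap.pair (TermMap.pi fun j => (TermMap.apply (f.symm j)).comp .fst) .snd
  · intro _
    refine hD.of_equiv hp (Equiv.uniqueProd D (PEmpty → A)).symm ?_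
    exact TermMap.pair (TermMap.pi fun j => j.elim) .id
  · intro κ hκ h _
    refine (hA _ (h inferInstance)).of_equiv hp (⟨fun p => (fun o => o.elim p.1 p.2.1, p.2.2),
      fun q => (q.1 none, fun i => q.1 (some i), q.2), fun _ => rfl, fun q => ?_⟩) ?_
    · refine Prod.ext (funext fun o => ?_) rfl
      cases o <;> rfl
    · refine TermMap.pair (TermMap.pi fun o => ?_) (by fun_prop)
      cases o
      · exact TermMap.fst
      · exact (TermMap.apply _).comp (by fun_prop)

theorem sortProd (hp : DensePair π e) (κ μ : Type) [Finite κ] [Finite μ] :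
    FiniteFiberChoice π e ((κ → V) × (μ → W)) := by
  refine (pow.{w, u, v, u, v} hp (fun D _ hD => hD.home hp) κ
    ((pow.{w, u, v, v, 0} hp (fun D _ hD => hD.quo hp) μ (unit hp)).of_equiv hp
      (Equiv.prodPUnit (μ → W)) .fst))

end FiniteFiberChoice

/-! ### Canonical choice in arbitrary products of sorts -/

variable {B : Type (max u v)} [SortProd V W B]

/-- The induction hypothesis, applied to the family indexed by `B × V`, chooses in the fibers over
the first coordinate `u`. This replaces `S b` by the set `Γ b` of pairs of a `u` with nonempty fiber
and a parameter `c` chosen there. Its fibers over `V` are finite, so `FiniteFiberChoice.sortProd`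
applies, and each chosen pair `(u, c)` leads back to the points `(u, y)` of `S b` with `ψ c y`. -/
theorem choosable_pow (hp : DensePair π e) (n : ℕ) : ∀ {B : Type (max u v)} [SortProd V W B]
    {S : B → (Fin n → V) → Prop}, (Dfn π e fun p : B × (Fin n → V) => S p.1 p.2) →
    Choosable π e (fun b b' => S b = S b') S := by
  induction n with
  | zero =>
    intro B _ S hS
    have h0 : TermMap π e (fun _ : B × Unit => (Fin.elim0 : Fin 0 → V)) :=
      TermMap.pi fun j => j.elim0
    exact Choosable.image hp (S' := fun b (_ : Unit) => S b Fin.elim0) (R := fun _ _ => True)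
      (hS.comp₂ (by fun_prop) h0) (.prop _)
      (fun b ⟨x, hx⟩ => ⟨(), by rwa [Subsingleton.elim x Fin.elim0] at hx⟩)
      (fun b b' h => ⟨h, by simp only [h]⟩) (fun _ _ _ => ⟨Fin.elim0, trivial⟩)
      (fun b _ x hz _ => by rwa [Subsingleton.elim x Fin.elim0]) (.unit _ _)
  | succ n ih =>
    intro B _ S hS
    have hcons : TermMap π e (fun p : V × (Fin n → V) => (Fin.cons p.1 p.2 : Fin (n + 1) → V)) := by
      refine TermMap.pi fun j => ?_
      refine Fin.cases ?_ (fun j => ?_) j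
      · exact TermMap.fst
      · simpa only [Fin.cons_succ] using (TermMap.apply j).comp (TermMap.snd (X := V))
    have hS' : Dfn π e fun p : (B × V) × (Fin n → V) => S p.1.1 (Fin.cons p.1.2 p.2) :=
      hS.comp₂ (by fun_prop)
        (hcons.comp (f := fun p : (B × V) × (Fin n → V) => (p.1.2, p.2)) (by fun_prop))
    obtain ⟨κ, μ, _, _, ψ, χ, h⟩ := ih (B := B × V) (S := fun p x => S p.1 (Fin.cons p.2 x)) hS'
    let Γ : B → V × (κ → V) × (μ → W) → Prop := fun b x =>
      (∃ y, S b (Fin.cons x.1 y)) ∧ χ (b, x.1) x.2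
    have hΓ : Dfn π e fun q : B × V × (κ → V) × (μ → W) => Γ q.1 q.2 :=
      .and (.ex hp (hS'.comp (g := fun q : (B × V × (κ → V) × (μ → W)) × (Fin n → V) =>
        ((q.1.1, q.1.2.1), q.2)))) h.dfn_χ.comp₂
    refine Choosable.image hp (S' := Γ)
      (R := fun z x => ∃ y, x = Fin.cons z.1 y ∧ ψ z.2 y) hΓ ?_ ?_ ?_ ?_ ?_
      (FiniteFiberChoice.sortProd hp κ μ B Γ hΓ fun b u => ?_)
    · refine .ex hp (.and (.eq (by fun_prop) ?_) h.dfn_ψ.comp₂)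
      exact hcons.comp (f := fun p : ((V × (κ → V) × (μ → W)) × (Fin (n + 1) → V)) × (Fin n → V) =>
        (p.1.1.1, p.2)) (by fun_prop)
    · rintro b ⟨x, hx⟩
      have hx' : ∃ y, S b (Fin.cons (x 0) y) := ⟨Fin.tail x, by rwa [Fin.cons_self_tail]⟩
      obtain ⟨c, hc⟩ := h.nonempty (b, x 0) hx'
      exact ⟨(x 0, c), hx', hc⟩
    · intro b b' hb
      have : Γ b = Γ b' := by
        funext x
        have := h.ext (b, x.1) (b', x.1) (by simp only [hb])
        simp only [Γ, hb, this]
      exact ⟨this, this⟩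
    · rintro b ⟨u, c⟩ ⟨hu, hc⟩
      obtain ⟨y, hy⟩ := h.exists_mem (b, u) c hu hc
      exact ⟨_, y, rfl, hy⟩
    · rintro b ⟨u, c⟩ _ ⟨hu, hc⟩ ⟨y, rfl, hy⟩
      exact h.subset (b, u) c hu hc y hy
    · by_cases hu : ∃ y, S b (Fin.cons u y)
      · exact (h.finite (b, u) hu).subset fun c hc => hc.2
      · simp [Γ, hu]

/-- Canonical finite choice for all definable families. -/
theorem Dfn.choosable (hp : DensePair π e) {X : Type*} [SortProd V W X] {S : B → X → Prop}
    (hS : Dfn π e fun p : B × X => S p.1 p.2) : Choosable π e (fun b b' => S b = S b') S := by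
  -- The sets are pulled back to a power of `V` along `cover`, and the subsets chosen there are
  -- projected to `X`.
  obtain ⟨n, ⟨f⟩⟩ := Finite.exists_equiv_fin (Idx V W X)
  have hc : TermMap π e (fun z : Fin n → V => (cover π fun i => z (f i) : X)) :=
    ⟨fun z i => z (.inl (f i, ())), fun i => .coord _, fun _ => rfl⟩
  have hS' : Dfn π e fun p : B × (Fin n → V) => S p.1 (cover π fun i => p.2 (f i)) :=
    hS.comp₂ (by fun_prop) (hc.comp (by fun_prop))
  refine Choosable.image hp (R := fun z x => x = cover π fun i => z (f i)) hS'
    (.eq (by fun_prop) (hc.comp (by fun_prop))) ?_ (fun b b' h => by simp only [h, and_self])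
    (fun _ _ _ => ⟨_, rfl⟩) (fun _ _ _ hz h => h ▸ hz) (choosable_pow hp n hS')
  rintro b ⟨x, hx⟩
  obtain ⟨z, rfl⟩ := cover_surjective hp x
  exact ⟨fun i => z (f.symm i), by simpa using hx⟩

end

section

/-! ### Definable predicates and formulas -/

/-- The two-sorted structure of a linear map `π : V → W` and an element `e` of `V`. -/
@[reducible]
def pairStructure (π : V →ₗ[F] W) (e : V) : LStructure.{w, u, v} F where
  Home := V
  Quo := W
  zero := 0
  one := e
  add x y := x + y
  smul a x := a • x
  lt x y := x < y
  memQ x := π x = 0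
  proj x := π x
  addQ x y := x + y
  smulQ a x := a • x

theorem termMap_evalHome {m : ℕ} (t : HomeTerm F m) :
    TermMap π e (fun x : Fin m → V => (pairStructure π e).evalHome x t) := by
  induction t with
  | var i => exact .apply i
  | zero => exact .zero
  | one => exact .one
  | add _ _ h₁ h₂ => exact h₁.add h₂
  | smul a _ h => exact h.smul a

theorem termMap_evalQuot {m n : ℕ} (t : QuotTerm F m n) :
    TermMap π e (fun p : (Fin m → V) × (Fin n → W) => (pairStructure π e).evalQuot p.1 p.2 t) := by
  induction t with
  | var i => exact (TermMap.apply i).comp .snd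
  | proj t => exact ((termMap_evalHome t).comp .fst).proj
  | add _ _ h₁ h₂ => exact h₁.addQ h₂
  | smul a _ h => exact h.smulQ a

theorem termMap_snoc {X : Type*} [SortProd V W X] (n : ℕ) :
    TermMap π e (fun p : (Fin n → X) × X => (Fin.snoc p.1 p.2 : Fin (n + 1) → X)) := by
  refine TermMap.pi fun j => Fin.lastCases ?_ (fun j => ?_) j
  · simpa only [Fin.snoc_last] using TermMap.snd
  · simpa only [Fin.snoc_castSucc] using (TermMap.apply j).comp (TermMap.fst (Y := X))

theorem termMap_append {X : Type*} [SortProd V W X] (m n : ℕ) :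
    TermMap π e (fun p : (Fin m → X) × (Fin n → X) => Fin.append p.1 p.2) := by
  refine TermMap.pi fun j => Fin.addCases (fun j => ?_) (fun j => ?_) j
  · simpa only [Fin.append_left] using (TermMap.apply j).comp (TermMap.fst (Y := Fin n → X))
  · simpa only [Fin.append_right] using (TermMap.apply j).comp (TermMap.snd (X := Fin m → X))

/-- This is quantifier elimination for the two-sorted language. Together with `Dfn.isFormula` it
allows formulas to be replaced by `Dfn` throughout. -/
theorem dfn_sat (hp : DensePair π e) {m n : ℕ} (φ : Formula F m n) :
    Dfn π e (fun p : (Fin m → V) × (Fin n → W) => (pairStructure π e).Sat φ p.1 p.2) := by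
  induction φ with
  | falsum => exact .prop _
  | eqHome s t => exact .eq ((termMap_evalHome s).comp .fst) ((termMap_evalHome t).comp .fst)
  | lt s t => exact .lt ((termMap_evalHome s).comp .fst) ((termMap_evalHome t).comp .fst)
  | memQ t => exact .eq ((termMap_evalHome t).comp .fst).proj .zeroQ
  | eqQuot s t => exact .eq (termMap_evalQuot s) (termMap_evalQuot t)
  | imp _ _ h₁ h₂ => exact h₁.imp h₂
  | @allHome m n _ h =>
    exact .all hp (h.comp (g := fun q : ((Fin m → V) × (Fin n → W)) × V =>
      (Fin.snoc q.1.1 q.2, q.1.2)) (((termMap_snoc m).comp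
        (f := fun q : ((Fin m → V) × (Fin n → W)) × V => (q.1.1, q.2)) (by fun_prop)).pair
        (by fun_prop)))
  | @allQuot m n _ h =>
    exact .all hp (h.comp (g := fun q : ((Fin m → V) × (Fin n → W)) × W =>
      (q.1.1, Fin.snoc q.1.2 q.2)) (TermMap.pair (by fun_prop) ((termMap_snoc n).comp
        (f := fun q : ((Fin m → V) × (Fin n → W)) × W => (q.1.2, q.2)) (by fun_prop))))

/-- The predicate `P` is defined by a formula. -/
def IsFormula (N : LStructure.{w, u, v} F) {m n : ℕ}
    (P : (Fin m → N.Home) → (Fin n → N.Quo) → Prop) : Prop :=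
  ∃ φ : Formula F m n, ∀ x y, N.Sat φ x y ↔ P x y

namespace IsFormula

variable {N : LStructure.{w, u, v} F} {m n : ℕ} {P R : (Fin m → N.Home) → (Fin n → N.Quo) → Prop}

theorem not (h : IsFormula N P) : IsFormula N (fun x y => ¬ P x y) :=
  h.elim fun φ hφ => ⟨.imp φ .falsum, fun x y => by simp [LStructure.Sat, hφ]⟩

theorem and (hP : IsFormula N P) (hR : IsFormula N R) : IsFormula N (fun x y => P x y ∧ R x y) := by
  obtain ⟨φ, hφ⟩ := hP
  obtain ⟨θ, hθ⟩ := hR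
  exact ⟨.imp (.imp φ (.imp θ .falsum)) .falsum, fun x y => by simp [LStructure.Sat, hφ, hθ]⟩

theorem forall_fin {k : ℕ} {P : Fin k → (Fin m → N.Home) → (Fin n → N.Quo) → Prop}
    (h : ∀ i, IsFormula N (P i)) : IsFormula N (fun x y => ∀ i, P i x y) := by
  induction k with
  | zero => exact ⟨.imp .falsum .falsum, fun x y => by simp [LStructure.Sat]⟩
  | succ k ih =>
    obtain ⟨φ, hφ⟩ := (h 0).and (ih fun i => h i.succ)
    exact ⟨φ, fun x y => by simp only [hφ, Fin.forall_fin_succ]⟩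

theorem exists_append {k : ℕ} {P : (Fin (m + k) → N.Home) → (Fin n → N.Quo) → Prop}
    (h : IsFormula N P) :
    IsFormula N (fun x y => ∃ x' : Fin k → N.Home, P (Fin.append x x') y) := by
  induction k with
  | zero =>
    obtain ⟨φ, hφ⟩ := h
    refine ⟨φ, fun x y => ?_⟩
    rw [hφ]
    refine ⟨fun h => ⟨Fin.elim0, by simpa using h⟩, fun ⟨x', h⟩ => ?_⟩
    rw [Subsingleton.elim x' Fin.elim0] at h
    simpa using h
  | succ k ih =>
    obtain ⟨φ, hφ⟩ := h
    have h1 : IsFormula N (fun (x : Fin (m + k) → N.Home) y => ∃ a, P (Fin.snoc x a) y) := by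
      refine ⟨.imp (.allHome (.imp φ .falsum)) .falsum, fun x y => ?_⟩
      simp [LStructure.Sat, hφ]
    obtain ⟨θ, hθ⟩ := ih h1
    refine ⟨θ, fun x y => ?_⟩
    rw [hθ]
    constructor
    · rintro ⟨x', a, h⟩
      exact ⟨Fin.snoc x' a, by rwa [Fin.append_snoc]⟩
    · rintro ⟨x', h⟩
      refine ⟨Fin.init x', x' (Fin.last k), ?_⟩
      rwa [← Fin.append_snoc, Fin.snoc_init_self]

end IsFormula

theorem AffineFn.exists_homeTerm {f : (ι → V) → V} (hf : AffineFn F e f) {m : ℕ}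
    (j : ι → HomeTerm F m) : ∃ t : HomeTerm F m, ∀ x, (pairStructure π e).evalHome x t =
      f (fun i => (pairStructure π e).evalHome x (j i)) := by
  induction hf with
  | coord i => exact ⟨j i, fun x => rfl⟩
  | const => exact ⟨.one, fun x => rfl⟩
  | zero => exact ⟨.zero, fun x => rfl⟩
  | add _ _ h₁ h₂ =>
    obtain ⟨s, hs⟩ := h₁
    obtain ⟨t, ht⟩ := h₂
    exact ⟨.add s t, fun x => by simp only [LStructure.evalHome, hs, ht]⟩
  | smul a _ h =>
    obtain ⟨s, hs⟩ := h
    exact ⟨.smul a s, fun x => by simp only [LStructure.evalHome, hs]⟩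

theorem QFDef.isFormula {P : (ι → V) → Prop} (hP : QFDef π e P) {m n : ℕ}
    (j : ι → HomeTerm F m) : IsFormula (pairStructure π e) (fun x (_ : Fin n → W) =>
      P (fun i => (pairStructure π e).evalHome x (j i))) := by
  induction hP with
  | pos hf =>
    obtain ⟨t, ht⟩ := hf.exists_homeTerm (π := π) j
    exact ⟨.lt .zero t, fun x y => by simp only [LStructure.Sat, ht, LStructure.evalHome]⟩
  | ker hf =>
    obtain ⟨t, ht⟩ := hf.exists_homeTerm (π := π) j
    exact ⟨.memQ t, fun x y => by simp only [LStructure.Sat, ht]⟩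
  | not _ h => exact h.not
  | and _ _ h₁ h₂ => exact h₁.and h₂

/-- Each quotient variable `y i` is replaced by an existentially quantified home-sort variable with
image `y i`; the condition on all the home-sort variables is quantifier-free. -/
theorem Dfn.isFormula (hp : DensePair π e) {m n : ℕ} {P : (Fin m → V) × (Fin n → W) → Prop}
    (hP : Dfn π e P) : IsFormula (pairStructure π e) (fun x y => P (x, y)) := by
  let j : Idx V W ((Fin m → V) × (Fin n → W)) → HomeTerm F (m + n) :=
    Sum.elim (Sum.elim (fun i : Fin m × Unit => .var (Fin.castAdd n i.1))
        (fun i : Fin n × Empty => i.2.elim))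
      (Sum.elim (fun i : Fin m × Empty => i.2.elim)
        (fun i : Fin n × Unit => .var (Fin.natAdd m i.1)))
  have h1 := QFDef.isFormula (n := n) hP j
  have h2 : IsFormula (pairStructure π e) (fun (x : Fin (m + n) → V) (y : Fin n → W) =>
      ∀ i, π (x (Fin.natAdd m i)) = y i) :=
    IsFormula.forall_fin fun i =>
      ⟨.eqQuot (.proj (.var (Fin.natAdd m i))) (.var i), fun x y => Iff.rfl⟩
  obtain ⟨φ, hφ⟩ := (h1.and h2).exists_append
  refine ⟨φ, fun x y => ?_⟩
  rw [hφ]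
  have key : ∀ x' : Fin n → V, (cover π fun i =>
      (pairStructure π e).evalHome (Fin.append x x') (j i) : (Fin m → V) × (Fin n → W)) =
      (x, fun i => π (x' i)) := fun x' => by
    refine Prod.ext (funext fun i => ?_) (funext fun i => ?_)
    · exact Fin.append_left x x' i
    · exact congrArg π (Fin.append_right x x' i)
  simp only [key, Fin.append_right]
  constructor
  · rintro ⟨x', h, hy⟩
    rwa [funext hy] at h
  · intro h
    choose f hf using hp.surj
    exact ⟨fun i => f (y i), by simpa [hf] using h, fun i => hf _⟩

theorem dfn_sat₂ (hp : DensePair π e) {m n k l : ℕ} (φ : Formula F (m + k) (n + l)) :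
    Dfn π e (fun p : ((Fin m → V) × (Fin n → W)) × ((Fin k → V) × (Fin l → W)) =>
      (pairStructure π e).Sat₂ φ p.1 p.2) :=
  (dfn_sat hp φ).comp (g := fun p : ((Fin m → V) × (Fin n → W)) × ((Fin k → V) × (Fin l → W)) =>
    (Fin.append p.1.1 p.2.1, Fin.append p.1.2 p.2.2))
    (((termMap_append m k).comp (f := fun p : ((Fin m → V) × (Fin n → W)) ×
      ((Fin k → V) × (Fin l → W)) => (p.1.1, p.2.1)) (by fun_prop)).pair
    ((termMap_append n l).comp (f := fun p : ((Fin m → V) × (Fin n → W)) ×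
      ((Fin k → V) × (Fin l → W)) => (p.1.2, p.2.2)) (by fun_prop)))

theorem Dfn.exists_sat₂ (hp : DensePair π e) {m n k l : ℕ}
    {P : (Fin m → V) × (Fin n → W) → (Fin k → V) × (Fin l → W) → Prop}
    (hP : Dfn π e fun p : ((Fin m → V) × (Fin n → W)) × ((Fin k → V) × (Fin l → W)) => P p.1 p.2) :
    ∃ φ : Formula F (m + k) (n + l), ∀ a b, (pairStructure π e).Sat₂ φ a b ↔ P a b := by
  have h : Dfn π e fun q : (Fin (m + k) → V) × (Fin (n + l) → W) =>
      P (fun i => q.1 (Fin.castAdd k i), fun i => q.2 (Fin.castAdd l i))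
        (fun i => q.1 (Fin.natAdd m i), fun i => q.2 (Fin.natAdd n i)) := hP.comp₂
  obtain ⟨φ, hφ⟩ := h.isFormula hp
  refine ⟨φ, fun a b => ?_⟩
  simp only [LStructure.Sat₂, hφ, Fin.append_left, Fin.append_right]

end

section

/-! ### Codes of definable sets -/

/-- The classes of a definable equivalence relation are weakly coded, uniformly. -/
theorem Dfn.exists_codes (hp : DensePair π e) {X : Type (max u v)} [SortProd V W X]
    {E : X → X → Prop} (hE : Dfn π e fun p : X × X => E p.1 p.2) (equiv : Equivalence E) :
    ∃ (k l : ℕ) (χ : X → (Fin k → V) × (Fin l → W) → Prop),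
      (Dfn π e fun p : X × ((Fin k → V) × (Fin l → W)) => χ p.1 p.2) ∧
      ∀ a, {c | χ a c}.Finite ∧ (∃ c, χ a c) ∧ ∀ b c, χ a c → (χ b c ↔ E a b) := by
  -- The family consists of the classes `E a`, each indexed by its own elements.
  obtain ⟨κ, μ, _, _, ψ, χ, h⟩ := hE.choosable hp
  obtain ⟨k, ⟨f⟩⟩ := Finite.exists_equiv_fin κ
  obtain ⟨l, ⟨g⟩⟩ := Finite.exists_equiv_fin μ
  let G : (Fin k → V) × (Fin l → W) ≃ (κ → V) × (μ → W) :=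
    (f.symm.arrowCongr (.refl V)).prodCongr (g.symm.arrowCongr (.refl W))
  have hG : TermMap π e G := TermMap.pair
    (TermMap.pi fun j => (TermMap.apply (f j)).comp .fst)
    (TermMap.pi fun j => (TermMap.apply (g j)).comp .snd)
  have hne : ∀ a, ∃ x, E a x := fun a => ⟨a, equiv.refl a⟩
  refine ⟨k, l, fun a c => χ a (G c), h.dfn_χ.comp₂, fun a => ⟨?_, ?_, fun b c hc => ⟨?_, ?_⟩⟩⟩
  · exact (h.finite a (hne a)).preimage G.injective.injOn
  · obtain ⟨c, hc⟩ := h.nonempty a (hne a)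
    exact ⟨G.symm c, by simpa using hc⟩
  · intro hc'
    -- The set `ψ (G c)` is nonempty and contained in the classes of both `a` and `b`, so these
    -- classes meet.
    obtain ⟨x, hx⟩ := h.exists_mem a _ (hne a) hc
    exact equiv.trans (h.subset a _ (hne a) hc x hx)
      (equiv.symm (h.subset b _ (hne b) hc' x hx))
  · intro hab
    have : E a = E b := funext fun x => propext
      ⟨fun h => equiv.trans (equiv.symm hab) h, fun h => equiv.trans hab h⟩
    exact (congrFun (h.ext a b this) _).mp hc

section

variable {m n k l : ℕ}

/-- A single relation between elements and codes serves for both formulas: fixing the element gives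
the codes, fixing a code gives the class. -/
theorem weaklyEliminates (hp : DensePair π e) (E : Formula F (m + m) (n + n))
    (equiv : Equivalence fun a b : (pairStructure π e).Tuple m n =>
      (pairStructure π e).Sat₂ E a b) :
    ∃ (k l : ℕ) (φ ψ : Formula F (m + k) (n + l)), ∀ a : (pairStructure π e).Tuple m n,
      (pairStructure π e).WeaklyCodes ((pairStructure π e).rightFiber ψ a) φ
        ((pairStructure π e).rightFiber E a) := by
  obtain ⟨k, l, χ, hχ, h⟩ := (dfn_sat₂ hp E).exists_codes hp (E := (pairStructure π e).Sat₂ E) equiv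
  obtain ⟨φ, hφ⟩ := hχ.exists_sat₂ hp
  refine ⟨k, l, φ, φ, fun a => ⟨?_, ?_, fun c => ?_⟩⟩
  · simpa only [LStructure.rightFiber, hφ] using (h a).1
  · exact (h a).2.1.imp fun c hc => (hφ a c).2 hc
  · simp only [LStructure.leftFiber, LStructure.rightFiber, Set.ext_iff, Set.mem_ofPred_eq, hφ]
    refine ⟨fun hc => (hc a).2 (equiv.refl a), fun hc b => (h a).2.2 b c hc⟩

/-- Uniform weak codes for the members of a definable family, provided that some definable set
is not a member. -/
theorem uniformlyWeaklyCoded_of_notMem (hp : DensePair π e) (φ : Formula F (m + k) (n + l))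
    {D : (Fin m → V) × (Fin n → W) → Prop} (hD : Dfn π e D)
    (good : (pairStructure π e).Tuple k l → Prop)
    (hgood : ∀ b, good b → (pairStructure π e).leftFiber φ b ≠ {x | D x}) :
    ∃ (k' l' : ℕ) (ψ : Formula F (m + k') (n + l')) (χ : Formula F (k' + k) (l' + l)),
      ∀ b, good b → (pairStructure π e).WeaklyCodes ((pairStructure π e).leftFiber χ b) ψ
        ((pairStructure π e).leftFiber φ b) := by
  have hφ := dfn_sat₂ hp φ
  let E : (Fin k → V) × (Fin l → W) → (Fin k → V) × (Fin l → W) → Prop := fun b b' =>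
    ∀ x, (pairStructure π e).Sat₂ φ x b ↔ (pairStructure π e).Sat₂ φ x b'
  have hE : Dfn π e fun p : ((Fin k → V) × (Fin l → W)) × ((Fin k → V) × (Fin l → W)) =>
      E p.1 p.2 := .all hp (.iff hφ.comp₂ hφ.comp₂)
  obtain ⟨k', l', χ, hχ, h⟩ := hE.exists_codes hp ⟨fun _ _ => Iff.rfl, fun h x => (h x).symm,
    fun h h' x => (h x).trans (h' x)⟩
  obtain ⟨χ', hχ'⟩ := Dfn.exists_sat₂ hp (P := fun c b => χ b c) hχ.comp₂
  -- Tuples that code no class are made to define `D`, so that they cannot define a member of the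
  -- family by accident.
  obtain ⟨ψ, hψ⟩ := Dfn.exists_sat₂ hp (P := fun x c =>
    (∃ b, χ b c ∧ (pairStructure π e).Sat₂ φ x b) ∨ (¬ ∃ b, χ b c) ∧ D x)
    (.or (.ex hp (.and hχ.comp₂ hφ.comp₂)) (.and (.not (.ex hp hχ.comp₂)) hD.comp))
  refine ⟨k', l', ψ, χ', fun b hb => ⟨?_, ?_, fun c => ?_⟩⟩
  · simpa only [LStructure.leftFiber, hχ'] using (h b).1
  · exact (h b).2.1.imp fun c hc => (hχ' c b).2 hc
  · have key : ∀ b', χ b' c → (pairStructure π e).leftFiber ψ c =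
        (pairStructure π e).leftFiber φ b' := fun b' hb' => by
      ext x
      simp only [LStructure.leftFiber, Set.mem_ofPred_eq, hψ]
      constructor
      · rintro (⟨b'', h1, h2⟩ | ⟨h1, -⟩)
        · exact (((h b'').2.2 b' c h1).1 hb' x).1 h2
        · exact absurd ⟨b', hb'⟩ h1
      · exact fun hx => .inl ⟨b', hb', hx⟩
    constructor
    · intro heq
      by_cases hc : ∃ b', χ b' c
      · obtain ⟨b', hb'⟩ := hc
        refine (hχ' c b).2 (((h b').2.2 b c hb').2 fun x => ?_)
        have := (key b' hb').symm.trans heq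
        exact Set.ext_iff.1 this x
      · refine absurd ?_ (hgood b hb)
        rw [← heq]
        ext x
        simp only [LStructure.leftFiber, Set.mem_ofPred_eq, hψ]
        exact ⟨fun h => h.elim (fun ⟨b', h', _⟩ => absurd ⟨b', h'⟩ hc) And.right,
          fun h => .inr ⟨hc, h⟩⟩
    · exact fun hc => key b ((hχ' c b).1 hc)

/-- Among nonempty sets, the empty set is a definable non-member. -/
theorem uniformlyWeaklyCodedOnNonempty (hp : DensePair π e) (φ : Formula F (m + k) (n + l)) :
    (pairStructure π e).UniformlyWeaklyCodedOnNonempty φ :=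
  uniformlyWeaklyCoded_of_notMem hp φ (D := fun _ => False) (.prop _) _ fun b hb h => by
    rw [h] at hb
    exact hb.elim fun _ h => h

/-- The empty set is treated separately: it is coded by the empty tuple via `falsum`. -/
theorem weaklyCoded (hp : DensePair π e) (φ : Formula F (m + k) (n + l))
    (b : (pairStructure π e).Tuple k l) :
    (pairStructure π e).WeaklyCoded ((pairStructure π e).leftFiber φ b) := by
  rcases Set.eq_empty_or_nonempty ((pairStructure π e).leftFiber φ b) with h | h
  · refine ⟨0, 0, .falsum, Set.univ, Set.toFinite _, ⟨(Fin.elim0, Fin.elim0), trivial⟩, fun c => ?_⟩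
    rw [h]
    exact iff_of_true (Set.eq_empty_of_forall_notMem fun _ h => h) trivial
  · obtain ⟨k', l', ψ, χ, H⟩ := uniformlyWeaklyCodedOnNonempty hp φ
    exact ⟨k', l', ψ, _, H b h⟩

/-- Some definable set does not belong to a given definable family in a product of sorts that
involves the home sort. -/
theorem exists_notMem_family (hp : DensePair π e) (hm : 1 ≤ m) (φ : Formula F (m + k) (n + l)) :
    ∃ D : (Fin m → V) × (Fin n → W) → Prop, Dfn π e D ∧
      ∀ b, (pairStructure π e).leftFiber φ b ≠ {x | D x} := by
  obtain ⟨m, rfl⟩ := Nat.exists_eq_add_of_le' hm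
  have hS : Dfn π e fun p : ((Fin k → V) × (Fin l → W)) × V =>
      (pairStructure π e).Sat₂ φ ((fun _ => p.2), (fun _ => 0)) p.1 := (dfn_sat₂ hp φ).comp₂
  obtain ⟨r, hr⟩ := hS.exists_tame hp
    (S := fun b v => (pairStructure π e).Sat₂ φ ((fun _ => v), (fun _ => 0)) b)
  -- Along the points `(v, …, v; 0, …, 0)`, every member of the family is tame with respect to `r`
  -- points, so a finite trace has at most `r` elements. The trace of this set consists of the `r +
  -- 1` multiples `0, e, …, r • e`.
  refine ⟨fun x => ∃ j : Fin (r + 1), x.1 0 = ((j : ℕ) : F) • e, .ex_finite fun j => .eq, ?_⟩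
  intro b hb
  obtain ⟨d, hd⟩ := hr b
  have hiff : ∀ v : V, (pairStructure π e).Sat₂ φ ((fun _ => v), (fun _ => 0)) b ↔
      ∃ j : Fin (r + 1), v = ((j : ℕ) : F) • e := fun v => Set.ext_iff.1 hb (_, _)
  have hall : ∀ j : Fin (r + 1), ∃ i, ((j : ℕ) : F) • e = d i := by
    by_contra hcon
    push Not at hcon
    obtain ⟨j, hj⟩ := hcon
    refine hd.infinite hp ((hiff _).2 ⟨j, rfl⟩) hj ?_
    refine (Set.finite_range fun j : Fin (r + 1) => ((j : ℕ) : F) • e).subset fun v hv => ?_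
    obtain ⟨j, rfl⟩ := (hiff v).1 hv
    exact ⟨j, rfl⟩
  choose f hf using hall
  obtain ⟨i, j, hij, hfij⟩ := Fintype.exists_ne_map_eq_of_card_lt f (by simp)
  have : ((i : ℕ) : F) • e = ((j : ℕ) : F) • e := by rw [hf, hf, hfij]
  exact hij (Fin.ext (by simpa using smul_left_injective F hp.pos.ne' this))

theorem uniformlyWeaklyCoded (hp : DensePair π e) (hm : 1 ≤ m) (φ : Formula F (m + k) (n + l)) :
    (pairStructure π e).UniformlyWeaklyCoded φ := by
  obtain ⟨D, hD, h⟩ := exists_notMem_family hp hm φ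
  obtain ⟨k', l', ψ, χ, H⟩ := uniformlyWeaklyCoded_of_notMem hp φ hD (fun _ => True) fun b _ => h b
  exact ⟨k', l', ψ, χ, fun b => H b trivial⟩

end

end

end Pair

/-! ### Models of the theory -/

section Models

variable {F : Type w} [Field F] [LinearOrder F] [IsStrictOrderedRing F]
  {M : Type u} [AddCommGroup M] [LinearOrder M] [IsOrderedAddMonoid M]
  [Module F M] [IsStrictOrderedModule F M]

/-- Every model of `T_POVS` is the structure of a linear map with proper dense kernel. -/
theorem models_induction {Q : Submodule F M} {e : M} (hQ : IsDensePair Q e)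
    {N : LStructure.{w, u₁, v₁} F} (hN : N.Models (TPOVS Q e))
    {motive : LStructure.{w, u₁, v₁} F → Prop}
    (h : ∀ (V : Type u₁) (W : Type v₁) [AddCommGroup V] [LinearOrder V] [IsOrderedAddMonoid V]
      [Module F V] [IsStrictOrderedModule F V] [AddCommGroup W] [Module F W] (π : V →ₗ[F] W)
      (e : V),
      DensePair π e → motive (pairStructure π e)) : motive N := by
  have tr : ∀ φ : Sentence F, (standard Q e).Sat φ Fin.elim0 Fin.elim0 →
    N.Sat φ Fin.elim0 Fin.elim0 := hN
  obtain ⟨V, W, zero, one, add, smul, lt, memQ, proj, addQ, smulQ⟩ := N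
  -- The axioms are transferred one sentence at a time from the standard structure; those that
  -- involve scalars are schemes with a sentence for every choice of scalars.
  have h_add_comm : ∀ x y, add x y = add y x := fun x y => tr (.allHome (.allHome
    (.eqHome (.add (.var 0) (.var 1)) (.add (.var 1) (.var 0)))))
    (fun (x y : M) => add_comm x y) x y
  have h_add_assoc : ∀ x y z, add (add x y) z = add x (add y z) := fun x y z =>
    tr (.allHome (.allHome (.allHome (.eqHome (.add (.add (.var 0) (.var 1)) (.var 2))
      (.add (.var 0) (.add (.var 1) (.var 2)))))))
      (fun (x y z : M) => add_assoc x y z) x y z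
  have h_zero_add : ∀ x, add zero x = x := fun x => tr (.allHome
    (.eqHome (.add .zero (.var 0)) (.var 0))) (fun x : M => zero_add x) x
  have h_neg : ∀ x : M, (-1 : F) • x + x = 0 := fun x => by rw [neg_one_smul, neg_add_cancel]
  have h_neg_add : ∀ x, add (smul (-1) x) x = zero := fun x => tr (.allHome
    (.eqHome (.add (.smul (-1) (.var 0)) (.var 0)) .zero))
    (fun x => by
      simp only [LStructure.Sat, LStructure.evalHome, standard]
      exact h_neg _) x
  have h_one_smul : ∀ x, smul 1 x = x := fun x => tr (.allHome
    (.eqHome (.smul 1 (.var 0)) (.var 0))) (fun x : M => one_smul F x) x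
  have h_mul_smul : ∀ a b x, smul (a * b) x = smul a (smul b x) := fun a b x => tr (.allHome
    (.eqHome (.smul (a * b) (.var 0)) (.smul a (.smul b (.var 0))))) (fun x : M => mul_smul a b x) x
  have h_smul_zero : ∀ a, smul a zero = zero := fun a => tr
    (.eqHome (.smul a .zero) .zero) (show a • (0 : M) = 0 from smul_zero a)
  have h_zero_smul : ∀ x, smul 0 x = zero := fun x => tr (.allHome
    (.eqHome (.smul 0 (.var 0)) .zero)) (fun x : M => zero_smul F x) x
  have h_smul_add : ∀ a x y, smul a (add x y) = add (smul a x) (smul a y) := fun a x y =>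
    tr (.allHome (.allHome (.eqHome (.smul a (.add (.var 0) (.var 1)))
      (.add (.smul a (.var 0)) (.smul a (.var 1)))))) (fun x y : M => smul_add a x y) x y
  have h_add_smul : ∀ a b x, smul (a + b) x = add (smul a x) (smul b x) := fun a b x =>
    tr (.allHome (.eqHome (.smul (a + b) (.var 0))
      (.add (.smul a (.var 0)) (.smul b (.var 0))))) (fun x : M => add_smul a b x) x
  have h_irrefl : ∀ x, ¬ lt x x := fun x => tr (.allHome (.imp (.lt (.var 0) (.var 0)) .falsum))
    (fun x : M => lt_irrefl x) x
  have h_trans : ∀ x y z, lt x y → lt y z → lt x z := fun x y z => tr (.allHome (.allHome (.allHome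
    (.imp (.lt (.var 0) (.var 1)) (.imp (.lt (.var 1) (.var 2)) (.lt (.var 0) (.var 2)))))))
    (fun (x y z : M) (h : x < y) (h' : y < z) => h.trans h') x y z
  have h_total : ∀ x y, ¬ lt x y → ¬ x = y → lt y x := fun x y => tr (.allHome (.allHome
    (.imp (.imp (.lt (.var 0) (.var 1)) .falsum) (.imp (.imp (.eqHome (.var 0) (.var 1)) .falsum)
      (.lt (.var 1) (.var 0))))))
    (fun (x y : M) (h : ¬ x < y) (h' : ¬ x = y) => lt_of_le_of_ne (not_lt.1 h) (Ne.symm h')) x y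
  have h_add_lt : ∀ x y z, lt x y → lt (add z x) (add z y) := fun x y z => tr
    (.allHome (.allHome (.allHome (.imp (.lt (.var 0) (.var 1))
      (.lt (.add (.var 2) (.var 0)) (.add (.var 2) (.var 1)))))))
    (fun (x y z : M) (h : x < y) => add_lt_add_right h z) x y z
  have h_smul_pos : ∀ a, 0 < a → ∀ x y, lt x y → lt (smul a x) (smul a y) := fun a ha x y => tr
    (.allHome (.allHome (.imp (.lt (.var 0) (.var 1))
      (.lt (.smul a (.var 0)) (.smul a (.var 1))))))
    (fun (x y : M) (h : x < y) => smul_lt_smul_of_pos_left h ha) x y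
  have h_pos_smul : ∀ a b, a < b → ∀ x, lt zero x → lt (smul a x) (smul b x) := fun a b hab x => tr
    (.allHome (.imp (.lt .zero (.var 0)) (.lt (.smul a (.var 0)) (.smul b (.var 0)))))
    (fun (x : M) (h : 0 < x) => smul_lt_smul_of_pos_right hab h) x
  have h_one : lt zero one := tr (.lt .zero .one) hQ.pos
  have h_mem : ∀ x, memQ x → proj x = proj zero := fun x => tr (.allHome (.imp (.memQ (.var 0))
    (.eqQuot (.proj (.var 0)) (.proj .zero))))
    (fun (x : M) (h : x ∈ Q) => show Q.mkQ x = Q.mkQ 0 by simpa using h) x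
  have h_mem' : ∀ x, proj x = proj zero → memQ x := fun x => tr (.allHome (.imp
    (.eqQuot (.proj (.var 0)) (.proj .zero)) (.memQ (.var 0))))
    (fun (x : M) (h : Q.mkQ x = Q.mkQ 0) => show x ∈ Q by simpa using h) x
  have h_proj_add : ∀ x y, proj (add x y) = addQ (proj x) (proj y) := fun x y => tr
    (.allHome (.allHome (.eqQuot (.proj (.add (.var 0) (.var 1)))
      (.add (.proj (.var 0)) (.proj (.var 1)))))) (fun x y : M => Q.mkQ.map_add x y) x y
  have h_proj_smul : ∀ a x, proj (smul a x) = smulQ a (proj x) := fun a x => tr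
    (.allHome (.eqQuot (.proj (.smul a (.var 0))) (.smul a (.proj (.var 0)))))
    (fun x : M => Q.mkQ.map_smul a x) x
  have h_surj : ∀ q, ¬ ∀ x, ¬ proj x = q := fun q => tr (.allQuot (.imp (.allHome (.imp
    (.eqQuot (.proj (.var 0)) (.var 0)) .falsum)) .falsum))
    (fun (q : M ⧸ Q) (h : ∀ x, ¬ Q.mkQ x = q) => (Q.mkQ_surjective q).elim h) q
  have h_dense : ∀ a b, lt a b → ¬ ∀ c, memQ c → lt a c → ¬ lt c b := fun a b => tr (.allHome
    (.allHome (.imp (.lt (.var 0) (.var 1)) (.imp (.allHome (.imp (.memQ (.var 2))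
      (.imp (.lt (.var 0) (.var 2)) (.imp (.lt (.var 2) (.var 1)) .falsum)))) .falsum))))
    (fun (a b : M) (h : a < b) (h' : ∀ c, c ∈ Q → a < c → ¬ c < b) =>
      (hQ.dense a b h).elim fun c hc => h' c hc.1 hc.2.1 hc.2.2) a b
  have h_ne : ¬ ∀ x, memQ x := tr (.imp (.allHome (.memQ (.var 0))) .falsum)
    (fun h : ∀ x : M, x ∈ Q => hQ.ne_top (eq_top_iff.2 fun x _ => h x))
  have surj : Function.Surjective proj := fun q => by
    by_contra hcon
    exact h_surj q fun x hx => hcon ⟨x, hx⟩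
  classical
  let _ : Zero V := ⟨zero⟩
  let _ : Add V := ⟨add⟩
  let _ : Neg V := ⟨smul (-1)⟩
  let _ : AddCommGroup V :=
    { AddGroup.ofLeftAxioms h_add_assoc h_zero_add h_neg_add with add_comm := h_add_comm }
  let : LinearOrder V :=
    { lt := lt, le := fun x y => lt x y ∨ x = y
      le_refl := fun x => .inr rfl
      le_trans := by
        rintro x y z (h | rfl) (h' | rfl)
        exacts [.inl (h_trans _ _ _ h h'), .inl h, .inl h', .inr rfl]
      le_antisymm := by
        rintro x y (h | rfl) (h' | h')
        exacts [absurd (h_trans _ _ _ h h') (h_irrefl x), h'.symm, rfl, rfl]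
      le_total := fun x y => by
        by_cases h1 : lt x y
        · exact .inl (.inl h1)
        · by_cases h2 : x = y
          · exact .inl (.inr h2)
          · exact .inr (.inl (h_total x y h1 h2))
      lt_iff_le_not_ge := fun x y => by
        constructor
        · refine fun h => ⟨.inl h, ?_⟩
          rintro (h' | rfl)
          exacts [h_irrefl x (h_trans _ _ _ h h'), h_irrefl _ h]
        · rintro ⟨h | rfl, h'⟩
          exacts [h, absurd (.inr rfl) h']
      toDecidableLE := Classical.decRel _ }
  let : Module F V :=
    { smul := smul, one_smul := h_one_smul, mul_smul := h_mul_smul, smul_zero := h_smul_zero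
      smul_add := h_smul_add, add_smul := h_add_smul, zero_smul := h_zero_smul }
  -- The laws of the quotient sort are inherited from the home sort, because `proj` is onto and
  -- commutes with the operations.
  let _ : Zero W := ⟨proj zero⟩
  let _ : Add W := ⟨addQ⟩
  let _ : Neg W := ⟨smulQ (-1)⟩
  let _ : AddCommGroup W :=
    { AddGroup.ofLeftAxioms
        (surj.forall₃.2 fun x y z =>
          show addQ (addQ (proj x) (proj y)) (proj z) = addQ (proj x) (addQ (proj y) (proj z)) by
            simp only [← h_proj_add, h_add_assoc])
        (surj.forall.2 fun x => show addQ (proj zero) (proj x) = proj x by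
          rw [← h_proj_add, h_zero_add])
        (surj.forall.2 fun x => show addQ (smulQ (-1) (proj x)) (proj x) = proj zero by
          rw [← h_proj_smul, ← h_proj_add, h_neg_add]) with
      add_comm := surj.forall₂.2 fun x y => show addQ (proj x) (proj y) = addQ (proj y) (proj x) by
          rw [← h_proj_add, ← h_proj_add, h_add_comm] }
  let : Module F W :=
    { smul := smulQ
      one_smul := surj.forall.2 fun x => show smulQ 1 (proj x) = proj x by
        rw [← h_proj_smul, h_one_smul]
      mul_smul := fun a b => surj.forall.2 fun x =>
        show smulQ (a * b) (proj x) = smulQ a (smulQ b (proj x)) by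
          simp only [← h_proj_smul, h_mul_smul]
      smul_zero := fun a => show smulQ a (proj zero) = proj zero by rw [← h_proj_smul, h_smul_zero]
      smul_add := fun a => surj.forall₂.2 fun x y =>
        show smulQ a (addQ (proj x) (proj y)) = addQ (smulQ a (proj x)) (smulQ a (proj y)) by
          simp only [← h_proj_smul, ← h_proj_add, h_smul_add]
      add_smul := fun a b => surj.forall.2 fun x =>
        show smulQ (a + b) (proj x) = addQ (smulQ a (proj x)) (smulQ b (proj x)) by
          simp only [← h_proj_smul, ← h_proj_add, h_add_smul]
      zero_smul := surj.forall.2 fun x => show smulQ 0 (proj x) = proj zero by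
        rw [← h_proj_smul, h_zero_smul] }
  have : IsOrderedAddMonoid V :=
    { add_le_add_left := fun x y hxy z => by
        rcases hxy with h | rfl
        · refine .inl ?_
          show lt (add x z) (add y z)
          rw [h_add_comm x, h_add_comm y]
          exact h_add_lt x y z h
        · exact .inr rfl }
  have : IsStrictOrderedModule F V :=
    { smul_lt_smul_of_pos_left := fun a ha x y hxy => h_smul_pos a ha x y hxy
      smul_lt_smul_of_pos_right := fun x hx a b hab => h_pos_smul a b hab x hx }
  let π : V →ₗ[F] W := { toFun := proj, map_add' := h_proj_add, map_smul' := h_proj_smul }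
  -- The predicate `Q` is the kernel of `π`, so the model is exactly a `pairStructure`.
  have hmemQ : memQ = fun x => π x = 0 := funext fun x => propext ⟨h_mem x, h_mem' x⟩
  subst hmemQ
  refine h V W π one ⟨h_one, surj, ?_, fun a b hab => ?_⟩
  · by_contra hcon
    push Not at hcon
    exact h_ne hcon
  · by_contra hcon
    exact h_dense a b hab fun c h1 h2 h3 => hcon ⟨c, h1, h2, h3⟩

end Models

end POVS

/-! ### The theorem for all models of `T_POVS` -/

theorem mainTheorem7 {F : Type w} [Field F] [LinearOrder F] [IsStrictOrderedRing F]
    {M : Type u} [AddCommGroup M] [LinearOrder M] [IsOrderedAddMonoid M]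
    [Module F M] [IsStrictOrderedModule F M]
    (Q : Submodule F M) (e : M) (hQ : POVS.IsDensePair Q e) :
    (∀ N : POVS.LStructure.{w, u₁, v₁} F, N.Models (POVS.TPOVS Q e) →
      -- every definable set, in any product of sorts, is weakly coded
      (∀ (m n k l : ℕ) (φ : POVS.Formula F (m + k) (n + l)) (b : N.Tuple k l),
        N.WeaklyCoded (N.leftFiber φ b)) ∧
      -- the coding is uniform if at least one of the coordinates is in the home sort
      (∀ (m n k l : ℕ) (φ : POVS.Formula F (m + k) (n + l)), 1 ≤ m →
        N.UniformlyWeaklyCoded φ) ∧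
      -- in all products of sorts, the coding is uniform on non-empty sets
      (∀ (m n k l : ℕ) (φ : POVS.Formula F (m + k) (n + l)),
        N.UniformlyWeaklyCodedOnNonempty φ)) ∧
    POVS.UniformlyWeaklyEliminatesImaginaries.{w, u₁, v₁} (POVS.TPOVS Q e) := by
  refine ⟨fun N hN => ?_, fun m n E N hN => ?_⟩
  · refine POVS.models_induction hQ hN (motive := fun N =>
      (∀ (m n k l : ℕ) (φ : POVS.Formula F (m + k) (n + l)) (b : N.Tuple k l),
        N.WeaklyCoded (N.leftFiber φ b)) ∧
      (∀ (m n k l : ℕ) (φ : POVS.Formula F (m + k) (n + l)), 1 ≤ m →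
        N.UniformlyWeaklyCoded φ) ∧
      (∀ (m n k l : ℕ) (φ : POVS.Formula F (m + k) (n + l)),
        N.UniformlyWeaklyCodedOnNonempty φ)) ?_
    intro V W _ _ _ _ _ _ _ π e hp
    exact ⟨fun m n k l φ b => POVS.weaklyCoded hp φ b,
      fun m n k l φ hm => POVS.uniformlyWeaklyCoded hp hm φ,
      fun m n k l φ => POVS.uniformlyWeaklyCodedOnNonempty hp φ⟩
  · refine POVS.models_induction hQ hN (motive := fun N =>
      Equivalence (fun a b : N.Tuple m n => N.Sat₂ E a b) →
      ∃ (k l : ℕ) (φ ψ : POVS.Formula F (m + k) (n + l)),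
        ∀ a : N.Tuple m n, N.WeaklyCodes (N.rightFiber ψ a) φ (N.rightFiber E a)) ?_
    intro V W _ _ _ _ _ _ _ π e hp
    exact POVS.weaklyEliminates hp E
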